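/- Consider the Erlang A ($M/M/m+M$) queue with $m\ge 1$ servers, arrival rate $\rho>0$, service rate $1$ and abandonment rate $\eta>0$: the number of customers $N(t)$, $t\ge 0$, is a time-homogeneous birth–death Markov chain on $\{0,1,2,\dots\}$ with birth rate $\rho$ in every state and death rate $j$ in state $j\le m$, $m+(j-m)\eta$ in state $j>m$. Let $0\le n_0\le m$ with $P[N(0)=n_0]>0$, let $p_n(t)=P[N(t)=n\mid N(0)=n_0]$, and let $\theta\in\mathbb C$ with $\operatorname{Re}\theta>0$. For $n\in\mathbb Z$ put $$F_n(\theta)=\frac1{2\pi i}\int_{C_0}\frac{e^{\rho z}}{z^{n+1}(1-z)^{\theta}}\,dz,\qquad G_n(\theta)=\frac1{2\pi i}\int_{C_1}\frac{e^{\rho z}}{z^{n+1}(z-1)^{\theta}}\,dz,$$ $$H_n(\theta;m)=\frac1{2\pi i}\int_{C_1}\frac{e^{\rho z/\eta}}{(z-1)^{\theta/\eta}\,z^{n+1-m}\,z^{m/\eta}}\,dz,$$ where the non-integer powers are principal branches, $C_0$ is the circle $|z|=r$ with any $0<r<1$, traversed counterclockwise, and $C_1$ is, for any $\varepsilon>0$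 and $c>1$, the contour that runs from $-\infty-i\varepsilon$ to $-\infty+i\varepsilon$ along straight lines through $c-i\varepsilon$ and $c+i\varepsilon$, thus encircling $z=1$ counterclockwise. Write $H_n=H_n(\theta;m)$ and $F_n=F_n(\theta)$, $G_n=G_n(\theta)$. Then, for every integer $n\ge 0$, the Laplace transform $\widehat P_n(\theta)=\int_0^\infty e^{-\theta t}p_n(t)\,dt$ converges absolutely; moreover $F_mH_{m-1}-H_mF_{m-1}\ne 0$, and $$\widehat P_n(\theta)=\frac{n_0!}{m!}\,\rho^{m-n_0-1}\,\frac{F_{n_0}H_n}{F_mH_{m-1}-H_mF_{m-1}},\qquad n\ge m;$$ $$\widehat P_n(\theta)=\frac{n_0!\,\Gamma(\theta)e^{-\rho}}{\rho^{n_0+\theta}}\,F_{n_0}\left[G_n+\frac{H_mG_{m-1}-G_mH_{m-1}}{F_mH_{m-1}-H_mF_{m-1}}\,F_n\right],\qquad n_0\le n\le m;$$ $$\widehat P_n(\theta)=\frac{n_0!\,\Gamma(\theta)e^{-\rho}}{\rho^{n_0+\theta}}\,F_n\left[G_{n_0}+\frac{H_mG_{m-1}-G_mH_{m-1}}{F_mH_{m-1}-H_mF_{m-1}}\,F_{n_0}\right],\qquad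 0\le n\le n_0.$$ -/

import Mathlib

open scoped NNReal Topology

noncomputable section

namespace ErlangA

/-- Total departure rate (service completions and abandonments) when `j` customers are present:
each of the `m` servers works at rate `1`, each waiting customer leaves at rate `η`. -/
def deathRate (m : ℕ) (η : ℝ) (j : ℕ) : ℝ :=
  if j ≤ m then (j : ℝ) else (m : ℝ) + ((j : ℝ) - (m : ℝ)) * η

/-- The generator (`Q`-matrix) of the birth-death process with constant birth rate `ρ`
and the death rates `deathRate m η`. -/
def generator (m : ℕ) (ρ η : ℝ) (i j : ℕ) : ℝ :=
  if j = i + 1 then ρ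
  else if i = j + 1 then deathRate m η i
  else if i = j then -(ρ + deathRate m η i)
  else 0

/-- `p t i j` is an honest (stochastic) transition function on the state space `ℕ`, with
`p h i j = δ i j + q i j * h + o(h)` as `h ↓ 0`. -/
structure IsTransitionFunction (q : ℕ → ℕ → ℝ) (p : ℝ≥0 → ℕ → ℕ → ℝ) : Prop where
  nonneg : ∀ t i j, 0 ≤ p t i j
  hasSum_one : ∀ t i, HasSum (fun j => p t i j) 1
  zero : ∀ i j, p 0 i j = if i = j then 1 else 0
  chapman_kolmogorov : ∀ s t i j, HasSum (fun k => p s i k * p t k j) (p (s + t) i j)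
  rates : ∀ i j, Filter.Tendsto (fun h : ℝ≥0 => (p h i j - if i = j then 1 else 0) / (h : ℝ))
    (𝓝[>] 0) (𝓝 (q i j))

/-- `N` is, under `P`, a time-homogeneous continuous-time Markov chain on `ℕ` with
transition rates `q`. The Markov property is with respect to the history of `N`. -/
def IsMarkovChain {Ω : Type*} [MeasurableSpace Ω] (P : MeasureTheory.Measure Ω)
    (N : ℝ≥0 → Ω → ℕ) (q : ℕ → ℕ → ℝ) : Prop :=
  (∀ t, Measurable (N t)) ∧
  ∃ p : ℝ≥0 → ℕ → ℕ → ℝ, IsTransitionFunction q p ∧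
    ∀ (s h : ℝ≥0) (i j : ℕ) (A : Set Ω),
      @MeasurableSet Ω (⨆ (u : ℝ≥0) (_ : u ≤ s), MeasurableSpace.comap (N u) ⊤) A →
      P.real (A ∩ {ω | N s ω = i} ∩ {ω | N (s + h) ω = j}) =
        P.real (A ∩ {ω | N s ω = i}) * p h i j

/-- The queue length process of the Erlang A (`M/M/m+M`) queue with arrival rate `ρ`, service
rate `1` and abandonment rate `η`. -/
def IsErlangA {Ω : Type*} [MeasurableSpace Ω] (P : MeasureTheory.Measure Ω)
    (N : ℝ≥0 → Ω → ℕ) (m : ℕ) (ρ η : ℝ) : Prop :=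
  IsMarkovChain P N (generator m ρ η)

/-- `P[N(t) = n | N(0) = n₀]`. -/
def transientProb {Ω : Type*} [MeasurableSpace Ω] (P : MeasureTheory.Measure Ω)
    (N : ℝ≥0 → Ω → ℕ) (n₀ n : ℕ) (t : ℝ≥0) : ℝ :=
  (ProbabilityTheory.cond P {ω | N 0 ω = n₀}).real {ω | N t ω = n}

/-- The function `t ↦ exp (-θ t) P[N(t) = n | N(0) = n₀]`, to be used for `t > 0`. -/
def laplaceIntegrand {Ω : Type*} [MeasurableSpace Ω] (P : MeasureTheory.Measure Ω)
    (N : ℝ≥0 → Ω → ℕ) (n₀ n : ℕ) (θ : ℂ) (t : ℝ) : ℂ :=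
  Complex.exp (-θ * (t : ℂ)) * (transientProb P N n₀ n t.toNNReal : ℂ)

/-- The Laplace transform of `t ↦ P[N(t) = n | N(0) = n₀]`. -/
def laplaceProb {Ω : Type*} [MeasurableSpace Ω] (P : MeasureTheory.Measure Ω)
    (N : ℝ≥0 → Ω → ℕ) (n₀ n : ℕ) (θ : ℂ) : ℂ :=
  ∫ t in Set.Ioi (0 : ℝ), laplaceIntegrand P N n₀ n θ t

/-- The integral of `f` over the contour from `-∞ - iε` to `-∞ + iε` that runs along
`Im z = -ε` to `c - iε`, up to `c + iε`, and back along `Im z = ε`. For `ε > 0` and `c > 1`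
it encircles `z = 1` counterclockwise. -/
def loopIntegral (ε c : ℝ) (f : ℂ → ℂ) : ℂ :=
  (∫ x in Set.Iic c, f ((x : ℂ) - (ε : ℂ) * Complex.I))
    + Complex.I * (∫ y in (-ε)..ε, f ((c : ℂ) + (y : ℂ) * Complex.I))
    - ∫ x in Set.Iic c, f ((x : ℂ) + (ε : ℂ) * Complex.I)

/-- `F_n(θ)`, over the circle of radius `r` about `0` (with `0 < r < 1`). -/
def F (r ρ : ℝ) (n : ℤ) (θ : ℂ) : ℂ :=
  1 / (2 * (Real.pi : ℂ) * Complex.I) *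
    ∮ z in C(0, r), Complex.exp ((ρ : ℂ) * z) / (z ^ (n + 1) * (1 - z) ^ θ)

/-- `G_n(θ)`. -/
def G (ε c ρ : ℝ) (n : ℤ) (θ : ℂ) : ℂ :=
  1 / (2 * (Real.pi : ℂ) * Complex.I) *
    loopIntegral ε c fun z => Complex.exp ((ρ : ℂ) * z) / (z ^ (n + 1) * (z - 1) ^ θ)

/-- `H_n(θ; m)`. -/
def H (ε c ρ η : ℝ) (m : ℕ) (n : ℤ) (θ : ℂ) : ℂ :=
  1 / (2 * (Real.pi : ℂ) * Complex.I) *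
    loopIntegral ε c fun z => Complex.exp ((ρ : ℂ) * z / (η : ℂ)) /
      ((z - 1) ^ (θ / (η : ℂ)) * z ^ (n + 1 - (m : ℤ)) * z ^ ((m : ℂ) / (η : ℂ)))

end ErlangA

end

/-! Fix the target state `n` and regard the Laplace transform as a function `u` of the starting
state `i`. It is bounded by `1 / θ.re` and solves the backward resolvent equation with source at `n`
(`laplace_backward`). A maximum principle excludes nonzero bounded solutions of the homogeneous
equation (`bounded_solution_eq_zero`). Hence `u i` is the Green function `x (min i n) * y (max i n)
/ (ρ W)`, where `x` solves the homogeneous equation at every state, `y` is bounded and solves it at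
the states `≥ 1`, and `W` is their Wronskian at `n` (`green_function`).

The contour integrals supply `x` and `y`. The integral of a derivative along the contour vanishes,
which gives three-term recursions: `F` and `G` satisfy the forward equations below state `m`, `H`
those from state `m` on. Multiplication by reciprocal reversible weights turns forward solutions
into backward ones (`backwardEq_of_forward`). Because `F` vanishes at `-1`, weighted `F` is the
solution regular at zero, up to state `m`. Weighted `H` is the bounded solution on the right, and a
combination of `G` and `F` continues it to the left.

The analytic work concerns `H`: its weighted values must be bounded and not all zero. The loop is
opened to a vertical line, where Fourier inversion yields the real integral of `s ^ (a - 1) * exp s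
* (R - s) ^ (S - 1)` over `[0, R]` (`loopKernel_eq_integral`), from which both facts follow. Then
the denominator cannot vanish (`wronskian_ne_zero`): otherwise the regular solution would be
proportional to a bounded one near infinity, hence bounded, hence zero. Fourier inversion also
evaluates `G` at `-1`, the constant in the Wronskian of `F` and `G`; this is the source of the
factor `Γ(θ) e^{-ρ} ρ^{-θ}`. -/

noncomputable section

namespace ErlangA

open Filter MeasureTheory Set

/-! ### Transition functions: continuity in time and the Laplace-transformed backward equations. -/

namespace IsTransitionFunction

variable {q : ℕ → ℕ → ℝ} {p : ℝ≥0 → ℕ → ℕ → ℝ}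

theorem sum_le_one (hp : IsTransitionFunction q p) (t : ℝ≥0) (i : ℕ) (s : Finset ℕ) :
    ∑ k ∈ s, p t i k ≤ 1 :=
  sum_le_hasSum s (fun _ _ => hp.nonneg _ _ _) (hp.hasSum_one t i)

theorem le_one (hp : IsTransitionFunction q p) (t : ℝ≥0) (i j : ℕ) : p t i j ≤ 1 := by
  simpa using hp.sum_le_one t i {j}

/-- The omitted part of the Chapman–Kolmogorov sum lies between zero and the mass that `p h i` puts
outside `s`, uniformly in `t`. This uniformity lets the estimate pass through the Laplace transform.
-/
theorem abs_sub_sum_le (hp : IsTransitionFunction q p) (h t : ℝ≥0) (i n : ℕ) (s : Finset ℕ) :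
    |p (h + t) i n - ∑ k ∈ s, p h i k * p t k n| ≤ 1 - ∑ k ∈ s, p h i k := by
  have h1 := hp.chapman_kolmogorov h t i n
  have h2 := (hp.hasSum_one h i).sub h1
  have h3 := sum_le_hasSum s (fun k _ => mul_nonneg (hp.nonneg h i k) (hp.nonneg t k n)) h1
  have h4 := sum_le_hasSum s (fun k _ => by
    have := mul_le_mul_of_nonneg_left (hp.le_one t k n) (hp.nonneg h i k)
    linarith) h2
  rw [Finset.sum_sub_distrib] at h4
  rw [abs_of_nonneg (by linarith)]
  linarith

theorem tendsto_self (hp : IsTransitionFunction q p) (i : ℕ) :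
    Tendsto (fun h : ℝ≥0 => p h i i) (𝓝[>] 0) (𝓝 1) := by
  have h1 := hp.rates i i
  have h2 : Tendsto (fun h : ℝ≥0 => (h : ℝ)) (𝓝[>] 0) (𝓝 0) := by
    have : Tendsto (fun h : ℝ≥0 => (h : ℝ)) (𝓝 0) (𝓝 ((0 : ℝ≥0) : ℝ)) :=
      NNReal.continuous_coe.tendsto 0
    exact this.mono_left nhdsWithin_le_nhds
  have h3 := (h1.mul h2).add_const 1
  simp only [mul_zero, zero_add] at h3
  refine h3.congr' ?_
  filter_upwards [self_mem_nhdsWithin] with h hh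
  have : (h : ℝ) ≠ 0 := by exact_mod_cast (ne_of_gt hh)
  simp
  field_simp
  ring

theorem abs_sub_le (hp : IsTransitionFunction q p) (h t : ℝ≥0) (i n : ℕ) :
    |p (h + t) i n - p t i n| ≤ 2 * (1 - p h i i) := by
  have h1 := hp.abs_sub_sum_le h t i n {i}
  simp only [Finset.sum_singleton] at h1
  have h2 : |p h i i * p t i n - p t i n| ≤ 1 - p h i i := by
    rw [abs_le]
    constructor <;> nlinarith [hp.le_one h i i, hp.le_one t i n, hp.nonneg t i n]
  calc |p (h + t) i n - p t i n|
      = |(p (h + t) i n - p h i i * p t i n) + (p h i i * p t i n - p t i n)| := by ring_nf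
    _ ≤ _ := (abs_add_le _ _).trans (by linarith)

theorem continuous (hp : IsTransitionFunction q p) (i n : ℕ) :
    Continuous (fun t : ℝ≥0 => p t i n) := by
  rw [Metric.continuous_iff]
  intro t ε hε
  have h1 : ∀ᶠ h : ℝ≥0 in 𝓝[>] 0, 1 - ε / 2 < p h i i :=
    (hp.tendsto_self i).eventually (lt_mem_nhds (by linarith))
  rw [eventually_nhdsWithin_iff, Metric.eventually_nhds_iff] at h1
  obtain ⟨δ, hδ, h1⟩ := h1
  have key : ∀ a b : ℝ≥0, a < b → dist a b < δ → dist (p a i n) (p b i n) < ε := by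
    intro a b hab hd
    obtain ⟨h, rfl⟩ := exists_add_of_le hab.le
    have hh : 0 < h := by simpa using hab
    have := h1 (y := h) (by simpa [NNReal.dist_eq, abs_sub_comm] using hd) hh
    rw [dist_comm, Real.dist_eq, add_comm]
    have := hp.abs_sub_le h a i n
    linarith
  refine ⟨δ, hδ, fun a ha => ?_⟩
  rcases lt_trichotomy a t with hat | rfl | hat
  · exact key a t hat ha
  · simpa using hε
  · rw [dist_comm] at ha ⊢
    exact key t a hat ha

/-- The Laplace transform at `θ` of `t ↦ p t i n`. -/
def laplace (p : ℝ≥0 → ℕ → ℕ → ℝ) (θ : ℂ) (n i : ℕ) : ℂ :=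
  ∫ t in Ioi (0 : ℝ), Complex.exp (-θ * t) * (p t.toNNReal i n : ℂ)

theorem continuous_integrand (hp : IsTransitionFunction q p) (θ : ℂ) (i n : ℕ) :
    Continuous fun t : ℝ => Complex.exp (-θ * t) * (p t.toNNReal i n : ℂ) := by
  have h1 : Continuous fun t : ℝ => p t.toNNReal i n :=
    (hp.continuous i n).comp continuous_real_toNNReal
  have h2 : Continuous fun t : ℝ => (p t.toNNReal i n : ℂ) := Complex.continuous_ofReal.comp h1
  exact (by fun_prop : Continuous fun t : ℝ => Complex.exp (-θ * t)).mul h2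

theorem norm_exp_neg_mul (θ : ℂ) (t : ℝ) :
    ‖Complex.exp (-θ * t)‖ = Real.exp (-θ.re * t) := by
  rw [Complex.norm_exp]; simp

theorem norm_integrand_le (hp : IsTransitionFunction q p) (θ : ℂ) (i n : ℕ) (t : ℝ) :
    ‖Complex.exp (-θ * t) * (p t.toNNReal i n : ℂ)‖ ≤ Real.exp (-θ.re * t) := by
  rw [norm_mul, norm_exp_neg_mul, Complex.norm_real, Real.norm_eq_abs,
    abs_of_nonneg (hp.nonneg _ _ _)]
  exact mul_le_of_le_one_right (Real.exp_pos _).le (hp.le_one _ _ _)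

theorem integrableOn_exp_neg {σ : ℝ} (hσ : 0 < σ) (b : ℝ) :
    IntegrableOn (fun t : ℝ => Real.exp (-σ * t)) (Ioi b) :=
  integrableOn_exp_mul_Ioi (by linarith) b

theorem integrableOn_integrand (hp : IsTransitionFunction q p) {θ : ℂ} (hθ : 0 < θ.re)
    (i n : ℕ) (b : ℝ) :
    IntegrableOn (fun t : ℝ => Complex.exp (-θ * t) * (p t.toNNReal i n : ℂ)) (Ioi b) :=
  (integrableOn_exp_neg hθ b).mono' (hp.continuous_integrand θ i n).aestronglyMeasurable
    (Eventually.of_forall fun t => hp.norm_integrand_le θ i n t)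

theorem integral_exp_neg {σ : ℝ} (hσ : 0 < σ) :
    ∫ t in Ioi (0 : ℝ), Real.exp (-σ * t) = 1 / σ := by
  rw [integral_exp_mul_Ioi (by linarith) 0]
  simp

theorem norm_laplace_le (hp : IsTransitionFunction q p) {θ : ℂ} (hθ : 0 < θ.re)
    (n i : ℕ) : ‖laplace p θ n i‖ ≤ 1 / θ.re := by
  rw [← integral_exp_neg hθ]
  exact norm_integral_le_of_norm_le (integrableOn_exp_neg hθ 0)
    (Eventually.of_forall fun t => hp.norm_integrand_le θ i n t)

theorem integral_shift (hp : IsTransitionFunction q p) {θ : ℂ} (hθ : 0 < θ.re)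
    (n i : ℕ) (h : ℝ≥0) :
    ∫ t in Ioi (0 : ℝ), Complex.exp (-θ * t) * (p (h + t.toNNReal) i n : ℂ) =
      Complex.exp (θ * (h : ℝ)) * (laplace p θ n i -
        ∫ t in (0 : ℝ)..h, Complex.exp (-θ * t) * (p t.toNNReal i n : ℂ)) := by
  have h1 := (measurePreserving_add_right volume (h : ℝ)).setIntegral_preimage_emb
    (measurableEmbedding_addRight (h : ℝ))
    (fun t : ℝ => Complex.exp (-θ * t) * (p t.toNNReal i n : ℂ)) (Ioi (h : ℝ))
  rw [Set.preimage_add_const_Ioi, sub_self] at h1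
  have h2 := intervalIntegral.integral_interval_add_Ioi
    (hp.integrableOn_integrand hθ i n 0) (hp.integrableOn_integrand hθ i n (h : ℝ))
  rw [laplace, ← h2, add_sub_cancel_left, ← h1, ← integral_const_mul]
  refine setIntegral_congr_fun measurableSet_Ioi fun t ht => ?_
  have ht' : (0 : ℝ) ≤ t := le_of_lt ht
  have : (t + (h : ℝ)).toNNReal = h + t.toNNReal := by
    rw [Real.toNNReal_add ht' h.coe_nonneg, Real.toNNReal_coe, add_comm]
  simp only [this]
  rw [← mul_assoc, ← Complex.exp_add]
  congr 2
  push_cast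
  ring

theorem norm_sub_sum_laplace_le (hp : IsTransitionFunction q p) {θ : ℂ} (hθ : 0 < θ.re)
    (n i : ℕ) (s : Finset ℕ) (h : ℝ≥0) :
    ‖Complex.exp (θ * (h : ℝ)) * (laplace p θ n i -
        ∫ t in (0 : ℝ)..h, Complex.exp (-θ * t) * (p t.toNNReal i n : ℂ)) -
      ∑ k ∈ s, (p h i k : ℂ) * laplace p θ n k‖ ≤ (1 - ∑ k ∈ s, p h i k) * (1 / θ.re) := by
  have hcont : Continuous fun t : ℝ => Complex.exp (-θ * t) * (p (h + t.toNNReal) i n : ℂ) :=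
    (by fun_prop : Continuous fun t : ℝ => Complex.exp (-θ * t)).mul
      (Complex.continuous_ofReal.comp
        ((hp.continuous i n).comp (continuous_const.add continuous_real_toNNReal)))
  have hint : IntegrableOn (fun t : ℝ => Complex.exp (-θ * t) * (p (h + t.toNNReal) i n : ℂ))
      (Ioi 0) := by
    refine (integrableOn_exp_neg hθ 0).mono' hcont.aestronglyMeasurable
      (Eventually.of_forall fun t => ?_)
    rw [norm_mul, norm_exp_neg_mul, Complex.norm_real, Real.norm_eq_abs,
      abs_of_nonneg (hp.nonneg _ _ _)]
    exact mul_le_of_le_one_right (Real.exp_pos _).le (hp.le_one _ _ _)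
  have hsum : ∑ k ∈ s, (p h i k : ℂ) * laplace p θ n k =
      ∫ t in Ioi (0 : ℝ), ∑ k ∈ s, (p h i k : ℂ) *
        (Complex.exp (-θ * t) * (p t.toNNReal k n : ℂ)) := by
    rw [integral_finsetSum]
    · exact Finset.sum_congr rfl fun k _ => by rw [integral_const_mul, laplace]
    · exact fun k _ => (hp.integrableOn_integrand hθ k n 0).const_mul _
  rw [← hp.integral_shift hθ, hsum, ← integral_sub hint
    (integrable_finsetSum _ fun k _ => (hp.integrableOn_integrand hθ k n 0).const_mul _),
    ← integral_exp_neg hθ, ← integral_const_mul]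
  refine norm_integral_le_of_norm_le ((integrableOn_exp_neg hθ 0).const_mul _)
    (Eventually.of_forall fun t => ?_)
  have : Complex.exp (-θ * t) * (p (h + t.toNNReal) i n : ℂ) -
      ∑ k ∈ s, (p h i k : ℂ) * (Complex.exp (-θ * t) * (p t.toNNReal k n : ℂ)) =
      Complex.exp (-θ * t) *
        ((p (h + t.toNNReal) i n - ∑ k ∈ s, p h i k * p t.toNNReal k n : ℝ) : ℂ) := by
    push_cast
    rw [mul_sub, Finset.mul_sum]
    congr 1
    exact Finset.sum_congr rfl fun k _ => by ring
  rw [this, norm_mul, norm_exp_neg_mul, Complex.norm_real, Real.norm_eq_abs, mul_comm]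
  exact mul_le_mul_of_nonneg_right (hp.abs_sub_sum_le _ _ _ _ _) (Real.exp_pos _).le

/-- The Laplace transforms of a transition function satisfy the backward equations at every
state whose row of the rate matrix is finite and sums to zero. -/
theorem laplace_backward (hp : IsTransitionFunction q p) {θ : ℂ} (hθ : 0 < θ.re)
    (n i : ℕ) (s : Finset ℕ) (his : i ∈ s) (hs : ∑ k ∈ s, q i k = 0) :
    θ * laplace p θ n i - (if i = n then 1 else 0) =
      ∑ k ∈ s, (q i k : ℂ) * laplace p θ n k := by
  set g : ℝ → ℂ := fun t => Complex.exp (-θ * t) * (p t.toNNReal i n : ℂ) with hg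
  have hgc : Continuous g := hp.continuous_integrand θ i n
  -- For `h ≥ 0` this is the transform of `t ↦ p (h + t) i n` (`integral_shift`). Its derivative at
  -- `0` exists by continuity of `p` alone, so `p` is never differentiated at positive times.
  set A : ℝ → ℂ := fun h => Complex.exp (θ * h) * (laplace p θ n i - ∫ t in (0 : ℝ)..h, g t)
    with hA
  have hA' : HasDerivAt A (θ * laplace p θ n i - (if i = n then 1 else 0)) 0 := by
    have h1 : HasDerivAt (fun h : ℝ => ∫ t in (0 : ℝ)..h, g t) (g 0) 0 :=
      intervalIntegral.integral_hasDerivAt_right (hgc.intervalIntegrable _ _)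
        hgc.stronglyMeasurable.stronglyMeasurableAtFilter hgc.continuousAt
    have h2 : HasDerivAt (fun h : ℝ => Complex.exp (θ * h)) (Complex.exp (θ * (0 : ℝ)) * θ) 0 := by
      have := ((hasDerivAt_id (0 : ℝ)).ofReal_comp.const_mul θ).cexp
      simpa using this
    have h3 := h2.mul (h1.const_sub (laplace p θ n i))
    convert! h3 using 1
    simp [hg, hp.zero]
    split_ifs <;> simp [sub_eq_add_neg]
  have hlim0 : Tendsto (fun h : ℝ≥0 => (h : ℝ)) (𝓝[>] 0) (𝓝[≠] 0) := by
    refine tendsto_nhdsWithin_iff.mpr ⟨?_, ?_⟩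
    · have : Tendsto (fun h : ℝ≥0 => (h : ℝ)) (𝓝 0) (𝓝 ((0 : ℝ≥0) : ℝ)) :=
        NNReal.continuous_coe.tendsto 0
      exact this.mono_left nhdsWithin_le_nhds
    · filter_upwards [self_mem_nhdsWithin] with h hh
      simpa using (ne_of_gt hh)
  have hT1 := (hasDerivAt_iff_tendsto_slope.mp hA').comp hlim0
  have hT2 : Tendsto (fun h : ℝ≥0 => ∑ k ∈ s,
      (((p h i k - if i = k then 1 else 0) / (h : ℝ) : ℝ) : ℂ) * laplace p θ n k) (𝓝[>] 0)
      (𝓝 (∑ k ∈ s, (q i k : ℂ) * laplace p θ n k)) := by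
    refine tendsto_finsetSum _ fun k _ => ?_
    refine Tendsto.mul_const _ ?_
    exact (Complex.continuous_ofReal.tendsto _).comp (hp.rates i k)
  -- The row sums to zero over `s`, so the mass escaping from `s` in time `h` is `o(h)`.
  have hT3 : Tendsto (fun h : ℝ≥0 => (-∑ k ∈ s,
      ((p h i k - if i = k then 1 else 0) / (h : ℝ))) * (1 / θ.re)) (𝓝[>] 0) (𝓝 0) := by
    have := ((tendsto_finsetSum s fun k _ => hp.rates i k).neg).mul_const (1 / θ.re)
    simpa [hs] using this
  have hδ : ∑ k ∈ s, (if i = k then (1 : ℝ) else 0) = 1 := by simp [his]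
  have hδ' : ∑ k ∈ s, (((if i = k then (1 : ℝ) else 0 : ℝ)) : ℂ) * laplace p θ n k =
      laplace p θ n i := by
    rw [Finset.sum_eq_single i] <;> simp +contextual [his, eq_comm]
  have hle : ∀ᶠ h : ℝ≥0 in 𝓝[>] 0, ‖(slope A 0 ∘ fun h : ℝ≥0 => (h : ℝ)) h -
      ∑ k ∈ s, (((p h i k - if i = k then 1 else 0) / (h : ℝ) : ℝ) : ℂ) * laplace p θ n k‖ ≤
      (-∑ k ∈ s, ((p h i k - if i = k then 1 else 0) / (h : ℝ))) * (1 / θ.re) := by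
    filter_upwards [self_mem_nhdsWithin] with h hh
    have hh0 : (0 : ℝ) < h := by exact_mod_cast hh
    have hhc : ((h : ℝ) : ℂ) ≠ 0 := by exact_mod_cast hh0.ne'
    have hb := hp.norm_sub_sum_laplace_le hθ n i s h
    have e1 : (slope A 0 ∘ fun h : ℝ≥0 => (h : ℝ)) h -
        ∑ k ∈ s, (((p h i k - if i = k then 1 else 0) / (h : ℝ) : ℝ) : ℂ) * laplace p θ n k =
        (((h : ℝ) : ℂ))⁻¹ * (A h - ∑ k ∈ s, (p h i k : ℂ) * laplace p θ n k) := by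
      have e2 : ∑ k ∈ s, (((p h i k - if i = k then 1 else 0) / (h : ℝ) : ℝ) : ℂ) *
          laplace p θ n k = ((h : ℝ) : ℂ)⁻¹ *
          (∑ k ∈ s, (p h i k : ℂ) * laplace p θ n k - laplace p θ n i) := by
        rw [← hδ', ← Finset.sum_sub_distrib, Finset.mul_sum]
        refine Finset.sum_congr rfl fun k _ => ?_
        rw [Complex.ofReal_div, Complex.ofReal_sub]
        field_simp
      have e3 : A 0 = laplace p θ n i := by simp [hA]
      rw [e2, Function.comp, slope_def_module, e3, sub_zero, Complex.real_smul,
        Complex.ofReal_inv]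
      ring
    have e4 : (-∑ k ∈ s, ((p h i k - if i = k then 1 else 0) / (h : ℝ))) =
        (h : ℝ)⁻¹ * (1 - ∑ k ∈ s, p h i k) := by
      rw [← Finset.sum_div, Finset.sum_sub_distrib, hδ]
      field_simp
      ring
    rw [e1, e4, norm_mul, norm_inv, Complex.norm_real, Real.norm_eq_abs, abs_of_pos hh0, mul_assoc]
    exact mul_le_mul_of_nonneg_left hb (by positivity)
  have hfin := squeeze_zero_norm' hle hT3
  exact sub_eq_zero.mp (tendsto_nhds_unique (hT1.sub hT2) hfin)

end IsTransitionFunction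

end ErlangA

end

/-! ### Birth–death resolvent equations: uniqueness of bounded solutions and the Green function. -/

noncomputable section

namespace ErlangA

open Filter

/-- The homogeneous backward resolvent equation of a birth-death process, at the state `i`. -/
def BackwardEq (ρ : ℝ) (d : ℕ → ℝ) (θ : ℂ) (v : ℕ → ℂ) (i : ℕ) : Prop :=
  (θ + ρ + d i) * v i = ρ * v (i + 1) + d i * v (i - 1)

/-- A maximum principle: `‖v‖` minus a small multiple of a linearly growing supersolution attains
its maximum, and the equation at a positive maximum is contradictory because `θ.re > 0`. Unbounded
death rates do no harm, since deaths only lower the supersolution. -/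
theorem bounded_solution_eq_zero {ρ : ℝ} (hρ : 0 < ρ) {d : ℕ → ℝ} (hd : ∀ i, 0 ≤ d i) {θ : ℂ}
    (hθ : 0 < θ.re) {v : ℕ → ℂ} {B : ℝ} (hB : ∀ i, ‖v i‖ ≤ B)
    (h : ∀ i, BackwardEq ρ d θ v i) (i : ℕ) : v i = 0 := by
  by_contra hi
  have hv : 0 < ‖v i‖ := norm_pos_iff.mpr hi
  set σ := θ.re with hσ
  -- The shift `ρ / σ` gives `σ * f j ≥ ρ = ρ * (f (j + 1) - f j)`, so `f` is a supersolution.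
  set f : ℕ → ℝ := fun k => k + ρ / σ with hf
  have hfpos : ∀ k, 0 < f k := fun k => by positivity
  obtain ⟨ε, hε, hεi⟩ : ∃ ε > 0, ε * f i < ‖v i‖ :=
    ⟨‖v i‖ / (2 * f i), by have := hfpos i; positivity, by
      have := hfpos i; field_simp; linarith⟩
  set w : ℕ → ℝ := fun k => ‖v k‖ - ε * f k with hw
  -- Beyond `n` the penalty exceeds `B`, so `w ≤ 0` there and a maximum over a finite range is
  -- global.
  obtain ⟨n, hn⟩ := exists_nat_gt (B / ε)
  obtain ⟨j, hj, hjmax⟩ := Finset.exists_max_image (Finset.range (n + 1 + i)) w ⟨0, by simp⟩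
  have hwi : 0 < w i := by simp only [hw]; linarith
  have hwj : w i ≤ w j := hjmax i (by simp)
  have hmax : ∀ k, w k ≤ w j := by
    intro k
    by_cases hk : k < n + 1 + i
    · exact hjmax k (by simpa using hk)
    · have h1 : (n : ℝ) ≤ k := by exact_mod_cast (by omega : n ≤ k)
      have h2 : B < ε * n := by rw [div_lt_iff₀ hε] at hn; linarith
      have h3 : ε * n ≤ ε * f k := by
        apply mul_le_mul_of_nonneg_left _ hε.le
        have : 0 < ρ / σ := by positivity
        simp only [hf]; linarith
      have : w k ≤ 0 := by simp only [hw]; linarith [hB k]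
      linarith
  have key : (σ + ρ + d j) * ‖v j‖ ≤ ρ * ‖v (j + 1)‖ + d j * ‖v (j - 1)‖ := by
    have h1 : (σ + ρ + d j) ≤ ‖θ + ρ + d j‖ := by
      refine le_trans ?_ (Complex.re_le_norm _)
      simp [hσ]
    calc (σ + ρ + d j) * ‖v j‖ ≤ ‖θ + ρ + d j‖ * ‖v j‖ := by gcongr
      _ = ‖ρ * v (j + 1) + d j * v (j - 1)‖ := by rw [← norm_mul, h j]
      _ ≤ _ := by
        refine (norm_add_le _ _).trans (le_of_eq ?_)
        simp [abs_of_pos hρ, abs_of_nonneg (hd j)]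
  have e1 : ‖v j‖ = w j + ε * f j := by simp [hw]
  have e2 : ‖v (j + 1)‖ = w (j + 1) + ε * f (j + 1) := by simp [hw]
  have e3 : ‖v (j - 1)‖ = w (j - 1) + ε * f (j - 1) := by simp [hw]
  have hfd : d j * f (j - 1) ≤ d j * f j := by
    apply mul_le_mul_of_nonneg_left _ (hd j)
    simp [hf]
  have hf1 : f (j + 1) = f j + 1 := by simp [hf]; ring
  have hσf : ρ ≤ σ * f j := by
    have : σ * f j = σ * j + ρ := by simp only [hf]; field_simp
    rw [this]; have : 0 ≤ σ * j := by positivity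
    linarith
  have hm1 := mul_le_mul_of_nonneg_left (hmax (j + 1)) hρ.le
  have hm2 := mul_le_mul_of_nonneg_left (hmax (j - 1)) (hd j)
  have hp : 0 < σ * w j := by have := hwi.trans_le hwj; positivity
  rw [e1, e2, e3, hf1] at key
  have hε1 := mul_le_mul_of_nonneg_left hfd hε.le
  have hε2 := mul_le_mul_of_nonneg_left hσf hε.le
  nlinarith

theorem wronskian_succ {ρ : ℝ} {d : ℕ → ℝ} {θ : ℂ} {x y : ℕ → ℂ} {i : ℕ}
    (hx : BackwardEq ρ d θ x (i + 1)) (hy : BackwardEq ρ d θ y (i + 1)) :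
    ρ * (x (i + 2) * y (i + 1) - x (i + 1) * y (i + 2)) =
      d (i + 1) * (x (i + 1) * y i - x i * y (i + 1)) := by
  simp only [BackwardEq, Nat.add_sub_cancel] at hx hy
  linear_combination y (i + 1) * (-hx) + x (i + 1) * hy

/-- The candidate solves the same inhomogeneous equation and is bounded: `x` enters only at states
up to `n`. The difference is a bounded homogeneous solution, hence zero. The function `y` need not
solve the equation at `0`, because its equation is used only at states above `n`. -/
theorem green_function {ρ : ℝ} (hρ : 0 < ρ) {d : ℕ → ℝ} (hd : ∀ i, 0 ≤ d i) {θ : ℂ}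
    (hθ : 0 < θ.re) {x y u : ℕ → ℂ} {B B' : ℝ}
    (hx : ∀ i, BackwardEq ρ d θ x i) (hy : ∀ i, 1 ≤ i → BackwardEq ρ d θ y i)
    (hyB : ∀ i, ‖y i‖ ≤ B) (huB : ∀ i, ‖u i‖ ≤ B') (n : ℕ)
    (hw : x (n + 1) * y n - x n * y (n + 1) ≠ 0)
    (hu : ∀ i, (θ + ρ + d i) * u i - (if i = n then 1 else 0) =
      ρ * u (i + 1) + d i * u (i - 1)) (i : ℕ) :
    u i = x (min i n) * y (max i n) / (ρ * (x (n + 1) * y n - x n * y (n + 1))) := by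
  have hρ' : (ρ : ℂ) ≠ 0 := by exact_mod_cast hρ.ne'
  set W : ℂ := ρ * (x (n + 1) * y n - x n * y (n + 1)) with hW
  have hW0 : W ≠ 0 := mul_ne_zero hρ' hw
  set v : ℕ → ℂ := fun i => W * u i - x (min i n) * y (max i n) with hv
  have hv0 : v i = 0 := by
    refine bounded_solution_eq_zero hρ hd hθ (v := v)
      (B := ‖W‖ * B' + (∑ k ∈ Finset.range (n + 1), ‖x k‖) * B) ?_ ?_ i
    · intro k
      refine (norm_sub_le _ _).trans (add_le_add ?_ ?_)
      · rw [norm_mul]; gcongr; exact huB k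
      · rw [norm_mul]
        refine mul_le_mul ?_ (hyB _) (norm_nonneg _) (Finset.sum_nonneg fun _ _ => norm_nonneg _)
        exact Finset.single_le_sum (f := fun k => ‖x k‖) (fun _ _ => norm_nonneg _)
          (by simp)
    · intro k
      have huk := hu k
      simp only [BackwardEq, hv]
      rcases lt_trichotomy k n with hk | rfl | hk
      · have hxk := hx k
        simp only [BackwardEq] at hxk
        rw [if_neg hk.ne] at huk
        rw [min_eq_left hk.le, min_eq_left (by omega : k + 1 ≤ n), min_eq_left (by omega : k - 1 ≤ n),
          max_eq_right hk.le, max_eq_right (by omega : k + 1 ≤ n),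
          max_eq_right (by omega : k - 1 ≤ n)]
        linear_combination W * huk - y n * hxk
      · rw [if_pos rfl] at huk
        have hxk := hx k
        simp only [BackwardEq] at hxk
        rw [min_self, max_self, min_eq_right (by omega : k ≤ k + 1),
          max_eq_left (by omega : k ≤ k + 1), min_eq_left (by omega : k - 1 ≤ k),
          max_eq_right (by omega : k - 1 ≤ k)]
        linear_combination W * huk - y k * hxk + hW
      · have hyk := hy k (by omega)
        simp only [BackwardEq] at hyk
        rw [if_neg hk.ne'] at huk
        rw [min_eq_right hk.le, min_eq_right (by omega : n ≤ k + 1), min_eq_right (by omega : n ≤ k - 1),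
          max_eq_left hk.le, max_eq_left (by omega : n ≤ k + 1),
          max_eq_left (by omega : n ≤ k - 1)]
        linear_combination W * huk - x n * hyk
  rw [eq_div_iff hW0]
  simp only [hv] at hv0
  linear_combination hv0

end ErlangA

end

/-! ### Loop integrals: vanishing on derivatives and deformation to a vertical line. -/

noncomputable section

namespace ErlangA

open Filter MeasureTheory Set Complex

/-- The complement of the half-line `(-∞, 1]` in the complex plane. -/
def slitDomain : Set ℂ := {z | z.im ≠ 0 ∨ 1 < z.re}

theorem horizontal_mem_slitDomain {y : ℝ} (hy : y ≠ 0) (x : ℝ) :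
    (x : ℂ) + y * I ∈ slitDomain := by
  left; simpa using hy

theorem vertical_mem_slitDomain {c : ℝ} (hc : 1 < c) (y : ℝ) :
    (c : ℂ) + y * I ∈ slitDomain := by
  right; simpa using hc

theorem mem_slitPlane_of_mem_slitDomain {z : ℂ} (hz : z ∈ slitDomain) : z ∈ slitPlane := by
  rcases hz with h | h
  · exact Or.inr h
  · exact Or.inl (by linarith)

theorem sub_one_mem_slitPlane_of_mem_slitDomain {z : ℂ} (hz : z ∈ slitDomain) :
    z - 1 ∈ slitPlane := by
  rcases hz with h | h
  · exact Or.inr (by simpa using h)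
  · exact Or.inl (by simpa using h)

/-- Integrability of `f` along the contour of `loopIntegral ε c f`. -/
structure LoopIntegrable (ε c : ℝ) (f : ℂ → ℂ) : Prop where
  lower : IntegrableOn (fun x : ℝ => f ((x : ℂ) - (ε : ℂ) * I)) (Iic c)
  right : IntervalIntegrable (fun y : ℝ => f ((c : ℂ) + (y : ℂ) * I)) volume (-ε) ε
  upper : IntegrableOn (fun x : ℝ => f ((x : ℂ) + (ε : ℂ) * I)) (Iic c)

theorem loopIntegral_congr {ε c : ℝ} (hε : 0 < ε) (hc : 1 < c) {f g : ℂ → ℂ}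
    (h : EqOn f g slitDomain) : loopIntegral ε c f = loopIntegral ε c g := by
  have h1 : ∀ x : ℝ, f ((x : ℂ) - (ε : ℂ) * I) = g ((x : ℂ) - (ε : ℂ) * I) := fun x => by
    have := h (horizontal_mem_slitDomain (neg_ne_zero.mpr hε.ne') x)
    simpa [sub_eq_add_neg] using this
  have h2 : ∀ x : ℝ, f ((x : ℂ) + (ε : ℂ) * I) = g ((x : ℂ) + (ε : ℂ) * I) := fun x =>
    h (horizontal_mem_slitDomain hε.ne' x)
  have h3 : ∀ y : ℝ, f ((c : ℂ) + (y : ℂ) * I) = g ((c : ℂ) + (y : ℂ) * I) := fun y =>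
    h (vertical_mem_slitDomain hc y)
  simp only [loopIntegral, h1, h2, h3]

theorem loopIntegral_const_mul (ε c : ℝ) (k : ℂ) (f : ℂ → ℂ) :
    loopIntegral ε c (fun z => k * f z) = k * loopIntegral ε c f := by
  simp only [loopIntegral, integral_const_mul, intervalIntegral.integral_const_mul]
  ring

theorem LoopIntegrable.const_mul {ε c : ℝ} {f : ℂ → ℂ} (hf : LoopIntegrable ε c f) (k : ℂ) :
    LoopIntegrable ε c (fun z => k * f z) :=
  ⟨hf.lower.const_mul k, hf.right.const_mul k, hf.upper.const_mul k⟩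

theorem LoopIntegrable.add {ε c : ℝ} {f g : ℂ → ℂ} (hf : LoopIntegrable ε c f)
    (hg : LoopIntegrable ε c g) : LoopIntegrable ε c (fun z => f z + g z) :=
  ⟨hf.lower.add hg.lower, hf.right.add hg.right, hf.upper.add hg.upper⟩

theorem loopIntegral_add {ε c : ℝ} {f g : ℂ → ℂ} (hf : LoopIntegrable ε c f)
    (hg : LoopIntegrable ε c g) :
    loopIntegral ε c (fun z => f z + g z) = loopIntegral ε c f + loopIntegral ε c g := by
  simp only [loopIntegral]
  rw [integral_add hf.lower hg.lower, integral_add hf.upper hg.upper,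
    intervalIntegral.integral_add hf.right hg.right]
  ring

theorem loopIntegral_eq_zero_of_hasDerivAt {ε c : ℝ} (hε : 0 < ε) (hc : 1 < c) {f g : ℂ → ℂ}
    (hd : ∀ z ∈ slitDomain, HasDerivAt g (f z) z) (hf : LoopIntegrable ε c f)
    (hlow : Tendsto (fun x : ℝ => g ((x : ℂ) - (ε : ℂ) * I)) atBot (𝓝 0))
    (hupp : Tendsto (fun x : ℝ => g ((x : ℂ) + (ε : ℂ) * I)) atBot (𝓝 0)) :
    loopIntegral ε c f = 0 := by
  have h1 : ∀ y : ℝ, y ≠ 0 → ∀ x : ℝ, HasDerivAt (fun x : ℝ => g ((x : ℂ) + (y : ℂ) * I))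
      (f ((x : ℂ) + (y : ℂ) * I)) x := fun y hy x => by
    have hline : HasDerivAt (fun x : ℝ => (x : ℂ) + (y : ℂ) * I) 1 x :=
      (hasDerivAt_id x).ofReal_comp.add_const _
    have := (hd _ (horizontal_mem_slitDomain hy x)).comp x hline
    rwa [mul_one] at this
  have h2 : ∀ y : ℝ, HasDerivAt (fun y : ℝ => g ((c : ℂ) + (y : ℂ) * I))
      (I * f ((c : ℂ) + (y : ℂ) * I)) y := fun y => by
    have hline : HasDerivAt (fun y : ℝ => (c : ℂ) + (y : ℂ) * I) I y := by
      simpa using ((hasDerivAt_id y).ofReal_comp.mul_const I).const_add (c : ℂ)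
    have := (hd _ (vertical_mem_slitDomain hc y)).comp y hline
    rwa [mul_comm (f _)] at this
  have hneg : ∀ x : ℝ, (x : ℂ) - (ε : ℂ) * I = (x : ℂ) + ((-ε : ℝ) : ℂ) * I := fun x => by
    push_cast; ring
  have hlow' : IntegrableOn (fun x : ℝ => f ((x : ℂ) + ((-ε : ℝ) : ℂ) * I)) (Iic c) := by
    simpa only [hneg] using hf.lower
  simp only [hneg] at hlow
  simp only [loopIntegral, hneg]
  rw [integral_Iic_of_hasDerivAt_of_tendsto' (fun x _ => h1 ε hε.ne' x) hf.upper hupp,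
    integral_Iic_of_hasDerivAt_of_tendsto' (fun x _ => h1 (-ε) (neg_ne_zero.mpr hε.ne') x)
      hlow' hlow, ← intervalIntegral.integral_const_mul,
    intervalIntegral.integral_eq_sub_of_hasDerivAt (fun y _ => h2 y) (hf.right.const_mul I)]
  ring

theorem tendsto_mul_exp_neg_atTop {R : ℝ} (hR : 0 < R) :
    Tendsto (fun T : ℝ => T * Real.exp (-R * T)) atTop (𝓝 0) := by
  have := tendsto_rpow_mul_exp_neg_mul_atTop_nhds_zero 1 R hR
  simpa using this

/-- Rotation of a horizontal half-line into a vertical one, in the upper half-plane for `s = 1`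
and in the lower half-plane for `s = -1`. -/
theorem integral_horizontal_eq_vertical {f : ℂ → ℂ} (hf : DifferentiableOn ℂ f slitDomain)
    {M R b : ℝ} (hM : 0 ≤ M) (hR : 0 < R) (hb : 1 < b)
    (hbound : ∀ z : ℂ, z.im ≠ 0 → ‖f z‖ ≤ M * Real.exp (R * z.re) * |z.im| ^ (-b))
    {ε c s : ℝ} (hε : 0 < ε) (hs : s = 1 ∨ s = -1)
    (hh : IntegrableOn (fun x : ℝ => f ((x : ℂ) + ((s * ε : ℝ) : ℂ) * I)) (Iic c))
    (hv : IntegrableOn (fun y : ℝ => f ((c : ℂ) + ((s * y : ℝ) : ℂ) * I)) (Ioi ε)) :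
    ∫ x in Iic c, f ((x : ℂ) + ((s * ε : ℝ) : ℂ) * I) =
      -(I * s * ∫ y in Ioi ε, f ((c : ℂ) + ((s * y : ℝ) : ℂ) * I)) := by
  have hs0 : s ≠ 0 := by rcases hs with rfl | rfl <;> norm_num
  have habs : |s| = 1 := by rcases hs with rfl | rfl <;> norm_num
  have hrect : ∀ T : ℝ, ε < T →
      (∫ x in (-T)..c, f ((x : ℂ) + ((s * ε : ℝ) : ℂ) * I)) -
      (∫ x in (-T)..c, f ((x : ℂ) + ((s * T : ℝ) : ℂ) * I)) +
      I * s * (∫ y in ε..T, f ((c : ℂ) + ((s * y : ℝ) : ℂ) * I)) -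
      I * s * (∫ y in ε..T, f (((-T : ℝ) : ℂ) + ((s * y : ℝ) : ℂ) * I)) = 0 := by
    intro T hT
    have h1 := integral_boundary_rect_eq_zero_of_differentiableOn f
      (((-T : ℝ) : ℂ) + ((s * ε : ℝ) : ℂ) * I) ((c : ℂ) + ((s * T : ℝ) : ℂ) * I) (by
        refine hf.mono fun z hz => Or.inl ?_
        have hz2 := (mem_reProdIm.mp hz).2
        simp only [add_im, ofReal_im, mul_im, I_im, ofReal_re, I_re, mul_one, mul_zero,
          add_zero, zero_add] at hz2
        rcases hs with rfl | rfl
        · rw [uIcc_of_le (by linarith)] at hz2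
          have := hz2.1
          intro h0; linarith
        · rw [uIcc_of_ge (by linarith)] at hz2
          have := hz2.2
          intro h0; linarith)
    simp only [add_im, ofReal_im, mul_im, I_im, ofReal_re, I_re, mul_one, mul_zero,
      add_zero, zero_add, add_re, mul_re, smul_eq_mul, sub_self] at h1
    rw [← intervalIntegral.smul_integral_comp_mul_left (fun y : ℝ => f ((c : ℂ) + (y : ℂ) * I)),
      ← intervalIntegral.smul_integral_comp_mul_left
        (fun y : ℝ => f (((-T : ℝ) : ℂ) + (y : ℂ) * I))] at h1
    simp only [real_smul, ← mul_assoc] at h1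
    exact h1
  have t1 : Tendsto (fun T : ℝ => ∫ x in (-T)..c, f ((x : ℂ) + ((s * ε : ℝ) : ℂ) * I)) atTop
      (𝓝 (∫ x in Iic c, f ((x : ℂ) + ((s * ε : ℝ) : ℂ) * I))) :=
    intervalIntegral_tendsto_integral_Iic c hh tendsto_neg_atTop_atBot
  have t3 : Tendsto (fun T : ℝ => ∫ y in ε..T, f ((c : ℂ) + ((s * y : ℝ) : ℂ) * I)) atTop
      (𝓝 (∫ y in Ioi ε, f ((c : ℂ) + ((s * y : ℝ) : ℂ) * I))) :=
    intervalIntegral_tendsto_integral_Ioi ε hv tendsto_id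
  -- On the far horizontal side the length grows like `T` and the integrand decays like `T ^ (-b)`;
  -- this is where `b > 1` is needed.
  have t2 : Tendsto (fun T : ℝ => ∫ x in (-T)..c, f ((x : ℂ) + ((s * T : ℝ) : ℂ) * I)) atTop
      (𝓝 0) := by
    have hlim : Tendsto (fun T : ℝ => M * Real.exp (R * c) * (c * T ^ (-b) + T ^ (-(b - 1))))
        atTop (𝓝 0) := by
      have := (((tendsto_rpow_neg_atTop (by linarith : 0 < b)).const_mul c).add
        (tendsto_rpow_neg_atTop (by linarith : 0 < b - 1))).const_mul (M * Real.exp (R * c))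
      simpa using this
    refine squeeze_zero_norm' ?_ hlim
    filter_upwards [eventually_gt_atTop (|c|), eventually_gt_atTop 0] with T hT hT0
    have hcT : -T ≤ c := by linarith [neg_abs_le c]
    refine (intervalIntegral.norm_integral_le_of_norm_le_const (C := M * Real.exp (R * c) *
      T ^ (-b)) fun x hx => ?_).trans (le_of_eq ?_)
    · rw [uIoc_of_le hcT] at hx
      refine (hbound _ (by simpa using ⟨hs0, hT0.ne'⟩)).trans ?_
      simp only [add_im, ofReal_im, mul_im, I_im, ofReal_re, I_re, mul_one, mul_zero,
        add_zero, zero_add, add_re, mul_re, sub_zero, abs_mul, habs, one_mul, abs_of_pos hT0]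
      have := hx.2
      gcongr
    · rw [abs_of_nonneg (by linarith), show -(b - 1) = -b + 1 by ring, Real.rpow_add hT0,
        Real.rpow_one]
      ring
  -- On the far vertical side the factor `exp (-R * T)` beats the length.
  have t4 : Tendsto (fun T : ℝ => ∫ y in ε..T, f (((-T : ℝ) : ℂ) + ((s * y : ℝ) : ℂ) * I))
      atTop (𝓝 0) := by
    have hlim : Tendsto (fun T : ℝ => M * ε ^ (-b) * (T * Real.exp (-R * T))) atTop (𝓝 0) := by
      simpa using (tendsto_mul_exp_neg_atTop hR).const_mul (M * ε ^ (-b))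
    refine squeeze_zero_norm' ?_ hlim
    filter_upwards [eventually_gt_atTop ε] with T hT
    refine (intervalIntegral.norm_integral_le_of_norm_le_const (C := M * Real.exp (-R * T) *
      ε ^ (-b)) fun y hy => ?_).trans ?_
    · rw [uIoc_of_le hT.le] at hy
      have hy0 : 0 < y := hε.trans hy.1
      refine (hbound _ (by simpa using ⟨hs0, hy0.ne'⟩)).trans ?_
      simp only [add_im, ofReal_im, mul_im, I_im, ofReal_re, I_re, mul_one, mul_zero,
        add_zero, zero_add, add_re, mul_re, sub_zero, abs_mul, habs, one_mul, abs_of_pos hy0]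
      rw [mul_neg, ← neg_mul]
      refine mul_le_mul_of_nonneg_left ?_ (by positivity)
      exact Real.rpow_le_rpow_of_nonpos hε hy.1.le (by linarith)
    · rw [abs_of_pos (by linarith)]
      have : 0 ≤ M * Real.exp (-R * T) * ε ^ (-b) := by positivity
      nlinarith
  have hlim := ((t1.sub t2).add (t3.const_mul (I * s))).sub (t4.const_mul (I * s))
  have h0 := tendsto_nhds_unique (hlim.congr' (by
    filter_upwards [eventually_gt_atTop ε] with T hT
    exact hrect T hT)) tendsto_const_nhds
  linear_combination h0

/-- The two horizontal rays rotate to the vertical rays above `ε` and below `-ε`, which complete the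
short segment at `c` to a full line. -/
theorem loopIntegral_eq_vertical {f : ℂ → ℂ} (hf : DifferentiableOn ℂ f slitDomain)
    {M R b : ℝ} (hM : 0 ≤ M) (hR : 0 < R) (hb : 1 < b)
    (hbound : ∀ z : ℂ, z.im ≠ 0 → ‖f z‖ ≤ M * Real.exp (R * z.re) * |z.im| ^ (-b))
    {ε c : ℝ} (hε : 0 < ε) (hint : LoopIntegrable ε c f)
    (hv : Integrable (fun y : ℝ => f ((c : ℂ) + (y : ℂ) * I))) :
    loopIntegral ε c f = I * ∫ y : ℝ, f ((c : ℂ) + (y : ℂ) * I) := by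
  have hneg : ∀ x : ℝ, (x : ℂ) - (ε : ℂ) * I = (x : ℂ) + ((-1 * ε : ℝ) : ℂ) * I := fun x => by
    push_cast; ring
  have h1 := integral_horizontal_eq_vertical hf hM hR hb hbound hε (Or.inl rfl) (c := c)
    (by simpa using hint.upper) (by simpa using hv.integrableOn)
  have hvneg : Integrable (fun y : ℝ => f ((c : ℂ) + ((-y : ℝ) : ℂ) * I)) := hv.comp_neg
  have h2 := integral_horizontal_eq_vertical hf hM hR hb hbound hε (Or.inr rfl) (c := c)
    (by simpa only [hneg] using hint.lower) (by simpa only [neg_one_mul] using hvneg.integrableOn)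
  have h3 := integral_comp_neg_Ioi ε (fun y : ℝ => f ((c : ℂ) + (y : ℂ) * I))
  simp only [loopIntegral, hneg]
  rw [h2]
  simp only [one_mul] at h1
  rw [h1]
  simp only [neg_one_mul]
  rw [h3]
  have h4 := intervalIntegral.integral_Iic_add_Ioi (b := ε) (f := fun y : ℝ => f ((c : ℂ) + (y : ℂ) * I))
    (μ := volume) hv.integrableOn hv.integrableOn
  have h5 := intervalIntegral.integral_Iic_sub_Iic (a := -ε) (b := ε)
    (f := fun y : ℝ => f ((c : ℂ) + (y : ℂ) * I))
    (μ := volume) hv.integrableOn hv.integrableOn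
  rw [← h4, ← h5]
  push_cast
  ring

end ErlangA

end

/-! ### The common kernel of `G` and `H`: bounds, recursions and the vertical-line formula. -/

noncomputable section

namespace ErlangA

open Filter MeasureTheory Set Complex

/-- The integrand `exp (R z) (z - 1) ^ (-a) z ^ (-S)`. -/
def kernel (a : ℂ) (S R : ℝ) (z : ℂ) : ℂ :=
  exp (R * z) * (z - 1) ^ (-a) * z ^ (-(S : ℂ))

/-- The normalized loop integral of `kernel a S R`. -/
def loopKernel (ε c : ℝ) (a : ℂ) (S R : ℝ) : ℂ :=
  1 / (2 * (Real.pi : ℂ) * I) * loopIntegral ε c (kernel a S R)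

theorem hasDerivAt_kernel (a : ℂ) (S R : ℝ) {z : ℂ} (hz : z ∈ slitDomain) :
    HasDerivAt (kernel a S R)
      (R * kernel a S R z - a * kernel (a + 1) S R z - S * kernel a (S + 1) R z) z := by
  have h1 : HasDerivAt (fun z : ℂ => exp (R * z)) (exp (R * z) * R) z := by
    simpa using ((hasDerivAt_id z).const_mul (R : ℂ)).cexp
  have h2 : HasDerivAt (fun z : ℂ => (z - 1) ^ (-a)) (-a * (z - 1) ^ (-a - 1) * 1) z :=
    ((hasDerivAt_id z).sub_const 1).cpow_const (sub_one_mem_slitPlane_of_mem_slitDomain hz)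
  have h3 : HasDerivAt (fun z : ℂ => z ^ (-(S : ℂ))) (-(S : ℂ) * z ^ (-(S : ℂ) - 1) * 1) z :=
    (hasDerivAt_id z).cpow_const (mem_slitPlane_of_mem_slitDomain hz)
  convert! (h1.mul h2).mul h3 using 1
  simp only [kernel, Pi.mul_apply]
  push_cast
  rw [show -(a + 1) = -a - 1 by ring, show -((S : ℂ) + 1) = -(S : ℂ) - 1 by ring]
  ring

theorem kernel_sub_one (a : ℂ) (S R : ℝ) {z : ℂ} (hz : z ∈ slitDomain) :
    kernel (a - 1) S R z = kernel a (S - 1) R z - kernel a S R z := by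
  have h1 := slitPlane_ne_zero (sub_one_mem_slitPlane_of_mem_slitDomain hz)
  have h2 := slitPlane_ne_zero (mem_slitPlane_of_mem_slitDomain hz)
  simp only [kernel]
  push_cast
  rw [show -(a - 1) = -a + 1 by ring, show -((S : ℂ) - 1) = -(S : ℂ) + 1 by ring,
    cpow_add _ _ h1, cpow_add _ _ h2, cpow_one, cpow_one]
  ring

theorem norm_cpow_neg_le {z a : ℂ} (hz : z ≠ 0) :
    ‖z ^ (-a)‖ ≤ Real.exp (Real.pi * |a.im|) * ‖z‖ ^ (-a.re) := by
  rw [norm_cpow_of_ne_zero hz, neg_re, neg_im, div_eq_mul_inv, ← Real.exp_neg, mul_comm]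
  gcongr
  rw [mul_neg, neg_neg]
  calc arg z * a.im ≤ |arg z * a.im| := le_abs_self _
    _ ≤ Real.pi * |a.im| := by
      rw [abs_mul]; gcongr; exact abs_arg_le_pi z

theorem norm_kernel_le {a : ℂ} (ha : 0 ≤ a.re) {S : ℝ} (hS : 0 ≤ S) (R : ℝ) {z : ℂ} {l : ℝ}
    (hl : 0 < l) (h1 : l ≤ ‖z - 1‖) (h2 : l ≤ ‖z‖) :
    ‖kernel a S R z‖ ≤
      Real.exp (Real.pi * |a.im|) * Real.exp (R * z.re) * l ^ (-(a.re + S)) := by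
  have hz1 : z - 1 ≠ 0 := norm_pos_iff.mp (hl.trans_le h1)
  have hz2 : z ≠ 0 := norm_pos_iff.mp (hl.trans_le h2)
  have e1 : ‖(z - 1) ^ (-a)‖ ≤ Real.exp (Real.pi * |a.im|) * l ^ (-a.re) :=
    (norm_cpow_neg_le hz1).trans (mul_le_mul_of_nonneg_left
      (Real.rpow_le_rpow_of_nonpos hl h1 (by linarith)) (Real.exp_pos _).le)
  have e2 : ‖z ^ (-(S : ℂ))‖ ≤ l ^ (-S) := by
    rw [← ofReal_neg, norm_cpow_real]
    exact Real.rpow_le_rpow_of_nonpos hl h2 (by linarith)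
  have e3 : ‖exp (R * z)‖ = Real.exp (R * z.re) := by rw [norm_exp]; simp
  rw [kernel, norm_mul, norm_mul, e3, neg_add, Real.rpow_add hl]
  calc Real.exp (R * z.re) * ‖(z - 1) ^ (-a)‖ * ‖z ^ (-(S : ℂ))‖
      ≤ Real.exp (R * z.re) * (Real.exp (Real.pi * |a.im|) * l ^ (-a.re)) * l ^ (-S) := by
        gcongr
    _ = _ := by ring

theorem norm_kernel_le_im {a : ℂ} (ha : 0 ≤ a.re) {S : ℝ} (hS : 0 ≤ S) (R : ℝ) {z : ℂ}
    (hz : z.im ≠ 0) :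
    ‖kernel a S R z‖ ≤
      Real.exp (Real.pi * |a.im|) * Real.exp (R * z.re) * |z.im| ^ (-(a.re + S)) :=
  norm_kernel_le ha hS R (abs_pos.mpr hz)
    (by simpa using abs_im_le_norm (z - 1)) (abs_im_le_norm z)

theorem continuousOn_kernel (a : ℂ) (S R : ℝ) : ContinuousOn (kernel a S R) slitDomain :=
  fun _ hz => (hasDerivAt_kernel a S R hz).continuousAt.continuousWithinAt

theorem continuous_kernel_horizontal (a : ℂ) (S R : ℝ) {y : ℝ} (hy : y ≠ 0) :
    Continuous fun x : ℝ => kernel a S R ((x : ℂ) + (y : ℂ) * I) :=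
  (continuousOn_kernel a S R).comp_continuous (by fun_prop) (horizontal_mem_slitDomain hy)

theorem continuous_kernel_vertical (a : ℂ) (S R : ℝ) {c : ℝ} (hc : 1 < c) :
    Continuous fun y : ℝ => kernel a S R ((c : ℂ) + (y : ℂ) * I) :=
  (continuousOn_kernel a S R).comp_continuous (by fun_prop) (vertical_mem_slitDomain hc)

theorem norm_kernel_horizontal_le {a : ℂ} (ha : 0 ≤ a.re) {S : ℝ} (hS : 0 ≤ S) (R : ℝ) {y : ℝ}
    (hy : y ≠ 0) (x : ℝ) :
    ‖kernel a S R ((x : ℂ) + (y : ℂ) * I)‖ ≤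
      Real.exp (Real.pi * |a.im|) * |y| ^ (-(a.re + S)) * Real.exp (R * x) := by
  have := norm_kernel_le_im ha hS R (z := (x : ℂ) + (y : ℂ) * I) (by simpa using hy)
  simp only [add_im, ofReal_im, mul_im, I_im, ofReal_re, I_re, mul_one, mul_zero,
    add_zero, zero_add, add_re, mul_re, sub_self] at this
  linarith

theorem integrableOn_kernel_horizontal {a : ℂ} (ha : 0 ≤ a.re) {S : ℝ} (hS : 0 ≤ S) {R : ℝ}
    (hR : 0 < R) {y : ℝ} (hy : y ≠ 0) (c : ℝ) :
    IntegrableOn (fun x : ℝ => kernel a S R ((x : ℂ) + (y : ℂ) * I)) (Iic c) :=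
  ((integrableOn_exp_mul_Iic hR c).const_mul _).mono'
    (continuous_kernel_horizontal a S R hy).aestronglyMeasurable
    (Eventually.of_forall (norm_kernel_horizontal_le ha hS R hy))

theorem tendsto_kernel_horizontal {a : ℂ} (ha : 0 ≤ a.re) {S : ℝ} (hS : 0 ≤ S) {R : ℝ}
    (hR : 0 < R) {y : ℝ} (hy : y ≠ 0) :
    Tendsto (fun x : ℝ => kernel a S R ((x : ℂ) + (y : ℂ) * I)) atBot (𝓝 0) := by
  refine squeeze_zero_norm (norm_kernel_horizontal_le ha hS R hy) ?_
  have : Tendsto (fun x : ℝ => Real.exp (R * x)) atBot (𝓝 0) :=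
    Real.tendsto_exp_atBot.comp (tendsto_id.const_mul_atBot hR)
  simpa using this.const_mul (Real.exp (Real.pi * |a.im|) * |y| ^ (-(a.re + S)))

theorem sub_mul_I_eq (x ε : ℝ) : (x : ℂ) - (ε : ℂ) * I = (x : ℂ) + ((-ε : ℝ) : ℂ) * I := by
  push_cast; ring

theorem loopIntegrable_kernel {ε c : ℝ} (hε : 0 < ε) (hc : 1 < c) {a : ℂ} (ha : 0 ≤ a.re) {S : ℝ}
    (hS : 0 ≤ S) {R : ℝ} (hR : 0 < R) : LoopIntegrable ε c (kernel a S R) where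
  lower := by
    simp only [sub_mul_I_eq]
    exact integrableOn_kernel_horizontal ha hS hR (neg_ne_zero.mpr hε.ne') c
  right := (continuous_kernel_vertical a S R hc).intervalIntegrable _ _
  upper := integrableOn_kernel_horizontal ha hS hR hε.ne' c

/-- This is the vanishing of the loop integral of the derivative of `kernel (a - 1) (S + 1) R`. -/
theorem loopKernel_recursion {ε c : ℝ} (hε : 0 < ε) (hc : 1 < c) {a : ℂ} (ha : 0 < a.re) {S : ℝ}
    (hS : 0 ≤ S) {R : ℝ} (hR : 0 < R) :
    R * loopKernel ε c a S R - (R + a + S) * loopKernel ε c a (S + 1) R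
      + (S + 1) * loopKernel ε c a (S + 2) R = 0 := by
  have hint : ∀ T : ℝ, 0 ≤ T → LoopIntegrable ε c (kernel a T R) := fun T hT =>
    loopIntegrable_kernel hε hc ha.le hT hR
  have i0 := (hint S hS).const_mul R
  have i1 := (hint (S + 1) (by linarith)).const_mul (-(R + a + S))
  have i2 := (hint (S + 2) (by linarith)).const_mul (S + 1)
  have h0 := loopIntegral_eq_zero_of_hasDerivAt hε hc
    -- The primitive equals `kernel (a - 1) (S + 1) R`, but is written as a difference because the
    -- decay bounds need a nonnegative real part of the exponent, which `a - 1` may lack.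
    (g := fun z => kernel a S R z - kernel a (S + 1) R z)
    (f := fun z => R * kernel a S R z + -(R + a + S) * kernel a (S + 1) R z +
      (S + 1) * kernel a (S + 2) R z) (fun z hz => by
        have e : ∀ᶠ w in 𝓝 z, kernel a S R w - kernel a (S + 1) R w
            = kernel (a - 1) (S + 1) R w := by
          have hopen : IsOpen slitDomain :=
            (isOpen_ne_fun continuous_im continuous_const).union
              (isOpen_lt continuous_const continuous_re)
          filter_upwards [hopen.mem_nhds hz] with w hw
          rw [kernel_sub_one _ _ _ hw, add_sub_cancel_right]
        refine ((hasDerivAt_kernel (a - 1) (S + 1) R hz).congr_of_eventuallyEq e).congr_deriv ?_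
        rw [kernel_sub_one _ _ _ hz, kernel_sub_one _ _ _ hz]
        simp only [sub_add_cancel, add_sub_cancel_right]
        rw [show S + 1 + 1 = S + 2 by ring]
        push_cast
        ring)
    ((i0.add i1).add i2)
    (by
      simp only [sub_mul_I_eq]
      simpa using (tendsto_kernel_horizontal ha.le hS hR (neg_ne_zero.mpr hε.ne')).sub
        (tendsto_kernel_horizontal ha.le (by linarith : 0 ≤ S + 1) hR (neg_ne_zero.mpr hε.ne')))
    (by
      simpa using (tendsto_kernel_horizontal ha.le hS hR hε.ne').sub
        (tendsto_kernel_horizontal ha.le (by linarith : 0 ≤ S + 1) hR hε.ne'))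
  rw [loopIntegral_add (i0.add i1) i2, loopIntegral_add i0 i1, loopIntegral_const_mul,
    loopIntegral_const_mul, loopIntegral_const_mul] at h0
  simp only [loopKernel]
  linear_combination 1 / (2 * (Real.pi : ℂ) * I) * h0

/-- It carries the evaluation at `S = 0` from `1 < a.re`, where the vertical integral converges
absolutely, down to `0 < a.re`. -/
theorem loopKernel_zero_recursion {ε c : ℝ} (hε : 0 < ε) (hc : 1 < c) {a : ℂ} (ha : 0 < a.re)
    {R : ℝ} (hR : 0 < R) :
    R * loopKernel ε c a 0 R = a * loopKernel ε c (a + 1) 0 R := by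
  have i0 := (loopIntegrable_kernel hε hc ha.le le_rfl hR).const_mul R
  have i1 := (loopIntegrable_kernel hε hc (a := a + 1) (by simp; linarith) le_rfl hR).const_mul (-a)
  have h0 := loopIntegral_eq_zero_of_hasDerivAt hε hc (g := kernel a 0 R)
    (f := fun z => R * kernel a 0 R z + -a * kernel (a + 1) 0 R z) (fun z hz =>
      (hasDerivAt_kernel a 0 R hz).congr_deriv (by push_cast; ring))
    (i0.add i1)
    (by
      simp only [sub_mul_I_eq]
      exact tendsto_kernel_horizontal ha.le le_rfl hR (neg_ne_zero.mpr hε.ne'))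
    (tendsto_kernel_horizontal ha.le le_rfl hR hε.ne')
  rw [loopIntegral_add i0 i1, loopIntegral_const_mul, loopIntegral_const_mul] at h0
  simp only [loopKernel]
  linear_combination 1 / (2 * (Real.pi : ℂ) * I) * h0

theorem integrable_kernel_vertical {c : ℝ} (hc : 1 < c) {a : ℂ} (ha : 0 ≤ a.re) {S : ℝ}
    (hS : 0 ≤ S) (haS : 1 < a.re + S) (R : ℝ) :
    Integrable fun y : ℝ => kernel a S R ((c : ℂ) + (y : ℂ) * I) := by
  -- With this constant `κ * (1 + |y|)` is below every number that dominates both `c - 1` and `|y|`,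
  -- in particular below `‖z‖` and `‖z - 1‖` on the line.
  set κ : ℝ := (c - 1) / (1 + (c - 1)) with hκ
  have hc1 : 0 < c - 1 := by linarith
  have hκ0 : 0 < κ := by positivity
  have hdom : Integrable fun y : ℝ => (1 + ‖y‖) ^ (-(a.re + S)) :=
    integrable_one_add_norm (by simpa using haS)
  refine (hdom.const_mul (Real.exp (Real.pi * |a.im|) * Real.exp (R * c) *
    κ ^ (-(a.re + S)))).mono' (continuous_kernel_vertical a S R hc).aestronglyMeasurable
    (Eventually.of_forall fun y => ?_)
  have hge : ∀ N : ℝ, c - 1 ≤ N → |y| ≤ N → κ * (1 + ‖y‖) ≤ N := by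
    intro N h1 h2
    rw [hκ, div_mul_eq_mul_div, div_le_iff₀ (by linarith), Real.norm_eq_abs]
    nlinarith
  have := norm_kernel_le ha hS R (z := (c : ℂ) + (y : ℂ) * I) (l := κ * (1 + ‖y‖))
    (by positivity)
    (hge _ (by simpa using re_le_norm ((c : ℂ) + (y : ℂ) * I - 1))
      (by simpa using abs_im_le_norm ((c : ℂ) + (y : ℂ) * I - 1)))
    (hge _ (le_trans (by linarith : c - 1 ≤ c) (by simpa using re_le_norm ((c : ℂ) + (y : ℂ) * I)))
      (by simpa using abs_im_le_norm ((c : ℂ) + (y : ℂ) * I)))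
  rw [Real.mul_rpow hκ0.le (by positivity)] at this
  simp only [ofReal_im, I_im, ofReal_re, I_re, mul_one, mul_zero,
    add_zero, add_re, mul_re, sub_self] at this
  linarith

theorem loopKernel_eq_vertical {ε c : ℝ} (hε : 0 < ε) (hc : 1 < c) {a : ℂ} (ha : 0 ≤ a.re)
    {S : ℝ} (hS : 0 ≤ S) (haS : 1 < a.re + S) {R : ℝ} (hR : 0 < R) :
    loopKernel ε c a S R =
      1 / (2 * (Real.pi : ℂ)) * ∫ y : ℝ, kernel a S R ((c : ℂ) + (y : ℂ) * I) := by
  rw [loopKernel, loopIntegral_eq_vertical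
    (fun z hz => (hasDerivAt_kernel a S R hz).differentiableAt.differentiableWithinAt)
    (Real.exp_pos (Real.pi * |a.im|)).le hR haS (fun z hz => norm_kernel_le_im ha hS R hz) hε
    (loopIntegrable_kernel hε hc ha hS hR) (integrable_kernel_vertical hc ha hS haS R)]
  have : (Real.pi : ℂ) ≠ 0 := by exact_mod_cast Real.pi_ne_zero
  field_simp

end ErlangA

end

/-! ### Gamma densities, Fourier inversion and the real integral for the loop kernel. -/

noncomputable section

namespace ErlangA

open Filter MeasureTheory Set Complex
open scoped FourierTransform

theorem continuousOn_ofReal_cpow (a : ℂ) :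
    ContinuousOn (fun t : ℝ => (t : ℂ) ^ (a - 1)) (Ioi 0) := fun t ht =>
  (continuousAt_ofReal_cpow_const t (a - 1) (Or.inr (ne_of_gt ht))).continuousWithinAt

theorem norm_cpow_mul_exp {a w : ℂ} {t : ℝ} (ht : 0 < t) :
    ‖(t : ℂ) ^ (a - 1) * exp (-(w * t))‖ = t ^ (a.re - 1) * Real.exp (-w.re * t) := by
  rw [norm_mul, norm_cpow_eq_rpow_re_of_pos ht, norm_exp]
  simp

theorem aestronglyMeasurable_cpow_mul_exp (a w : ℂ) :
    AEStronglyMeasurable (fun t : ℝ => (t : ℂ) ^ (a - 1) * exp (-(w * t)))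
      (volume.restrict (Ioi 0)) :=
  ((continuousOn_ofReal_cpow a).mul (by fun_prop)).aestronglyMeasurable measurableSet_Ioi

theorem integrableOn_rpow_mul_exp {s b : ℝ} (hs : 0 < s) (hb : 0 < b) :
    IntegrableOn (fun t : ℝ => t ^ (s - 1) * Real.exp (-b * t)) (Ioi 0) := by
  simpa using integrableOn_rpow_mul_exp_neg_mul_rpow (p := 1) (s := s - 1) (b := b)
    (by linarith) zero_lt_one hb

theorem integrableOn_cpow_mul_exp {a w : ℂ} (ha : 0 < a.re) (hw : 0 < w.re) :
    IntegrableOn (fun t : ℝ => (t : ℂ) ^ (a - 1) * exp (-(w * t))) (Ioi 0) := by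
  refine (integrableOn_rpow_mul_exp ha hw).mono' (aestronglyMeasurable_cpow_mul_exp a w) ?_
  filter_upwards [ae_restrict_mem measurableSet_Ioi] with t ht
  exact (norm_cpow_mul_exp ht).le

theorem differentiableAt_integral_cpow_mul_exp {a w : ℂ} (ha : 0 < a.re) (hw : 0 < w.re) :
    DifferentiableAt ℂ (fun w : ℂ => ∫ t in Ioi (0 : ℝ), (t : ℂ) ^ (a - 1) * exp (-(w * t))) w := by
  have hball : ∀ v ∈ Metric.ball w (w.re / 2), w.re / 2 < v.re := by
    intro v hv
    have h1 := abs_re_le_norm (v - w)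
    rw [Metric.mem_ball, dist_eq_norm] at hv
    rw [sub_re] at h1
    have := (abs_lt.mp (h1.trans_lt hv)).1
    linarith
  refine (hasDerivAt_integral_of_dominated_loc_of_deriv_le (μ := volume.restrict (Ioi (0 : ℝ)))
    (F := fun (w : ℂ) (t : ℝ) => (t : ℂ) ^ (a - 1) * exp (-(w * t)))
    (F' := fun (w : ℂ) (t : ℝ) => (t : ℂ) ^ (a - 1) * (exp (-(w * t)) * (-t)))
    (bound := fun t : ℝ => t ^ (a.re + 1 - 1) * Real.exp (-(w.re / 2) * t))
    (Metric.ball_mem_nhds w (by linarith : 0 < w.re / 2))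
    (Eventually.of_forall fun v => aestronglyMeasurable_cpow_mul_exp a v)
    (integrableOn_cpow_mul_exp ha hw) ?_ ?_
    (integrableOn_rpow_mul_exp (by linarith) (by linarith)) ?_).2.differentiableAt
  · exact ((continuousOn_ofReal_cpow a).mul (by fun_prop)).aestronglyMeasurable measurableSet_Ioi
  · filter_upwards [ae_restrict_mem measurableSet_Ioi] with t ht v hv
    have ht' : (0 : ℝ) < t := ht
    rw [← mul_assoc, norm_mul, norm_cpow_mul_exp ht, norm_neg, norm_real, Real.norm_eq_abs,
      abs_of_pos ht', show a.re + 1 - 1 = (a.re - 1) + 1 by ring, Real.rpow_add ht', Real.rpow_one]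
    have : Real.exp (-v.re * t) ≤ Real.exp (-(w.re / 2) * t) := by
      rw [Real.exp_le_exp]; nlinarith [hball v hv]
    have hp : 0 ≤ t ^ (a.re - 1) * t := by positivity
    nlinarith
  · filter_upwards with t v _
    have h1 : HasDerivAt (fun v : ℂ => -(v * t)) (-(t : ℂ)) v := (hasDerivAt_mul_const (t : ℂ)).fun_neg
    exact h1.cexp.const_mul _

/-- Both sides are analytic in `w` on the right half-plane and agree for real `w`, so the identity
theorem applies. -/
theorem integral_cpow_mul_exp_neg_mul_Ioi_complex {a w : ℂ} (ha : 0 < a.re) (hw : 0 < w.re) :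
    ∫ t in Ioi (0 : ℝ), (t : ℂ) ^ (a - 1) * exp (-(w * t)) = Gamma a * w ^ (-a) := by
  have hopen : IsOpen {w : ℂ | 0 < w.re} := isOpen_lt continuous_const continuous_re
  have h1 : AnalyticOnNhd ℂ
      (fun w : ℂ => ∫ t in Ioi (0 : ℝ), (t : ℂ) ^ (a - 1) * exp (-(w * t))) {w : ℂ | 0 < w.re} :=
    DifferentiableOn.analyticOnNhd (fun v hv =>
      (differentiableAt_integral_cpow_mul_exp ha hv).differentiableWithinAt) hopen
  have h2 : AnalyticOnNhd ℂ (fun w : ℂ => Gamma a * w ^ (-a)) {w : ℂ | 0 < w.re} :=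
    DifferentiableOn.analyticOnNhd (fun v hv =>
      (((differentiableAt_id).cpow_const (Or.inl hv)).const_mul _).differentiableWithinAt) hopen
  have hconn : IsPreconnected {w : ℂ | 0 < w.re} :=
    (convex_halfSpace_re_gt 0).isPreconnected
  refine h1.eqOn_of_preconnected_of_frequently_eq h2 hconn (z₀ := 1) (by simp) ?_ hw
  have hreal : ∀ r : ℝ, 0 < r → ∫ t in Ioi (0 : ℝ), (t : ℂ) ^ (a - 1) * exp (-((r : ℂ) * t)) =
      Gamma a * (r : ℂ) ^ (-a) := fun r hr => by
    rw [integral_cpow_mul_exp_neg_mul_Ioi ha hr, one_div, mul_comm,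
      inv_cpow _ _ (by rw [arg_ofReal_of_nonneg hr.le]; exact Real.pi_pos.ne), cpow_neg]
  have hseq : Tendsto (fun r : ℝ => (r : ℂ)) (𝓝[≠] 1) (𝓝[≠] 1) := by
    refine tendsto_nhdsWithin_iff.mpr ⟨?_, ?_⟩
    · have : Tendsto (fun r : ℝ => (r : ℂ)) (𝓝 1) (𝓝 ((1 : ℝ) : ℂ)) := continuous_ofReal.tendsto 1
      rw [ofReal_one] at this
      exact this.mono_left nhdsWithin_le_nhds
    · filter_upwards [self_mem_nhdsWithin] with r hr
      simpa using hr
  refine hseq.frequently (Eventually.frequently ?_)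
  filter_upwards [nhdsWithin_le_nhds (lt_mem_nhds (zero_lt_one : (0 : ℝ) < 1))] with r hr
  exact hreal r hr

/-- The function `x ^ (a - 1) exp (-μ x)` on the positive half-line, extended by zero. -/
def gammaFun (a : ℂ) (μ : ℝ) : ℝ → ℂ :=
  indicator (Ioi 0) fun t : ℝ => (t : ℂ) ^ (a - 1) * exp (-((μ : ℂ) * t))

theorem integrable_gammaFun {a : ℂ} (ha : 0 < a.re) {μ : ℝ} (hμ : 0 < μ) :
    Integrable (gammaFun a μ) :=
  (integrable_indicator_iff measurableSet_Ioi).mpr (integrableOn_cpow_mul_exp ha (by simpa using hμ))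

theorem fourier_gammaFun {a : ℂ} (ha : 0 < a.re) {μ : ℝ} (hμ : 0 < μ) (ξ : ℝ) :
    𝓕 (gammaFun a μ) ξ = Gamma a * ((μ : ℂ) + ((2 * Real.pi * ξ : ℝ) : ℂ) * I) ^ (-a) := by
  rw [Real.fourier_real_eq_integral_exp_smul,
    ← integral_cpow_mul_exp_neg_mul_Ioi_complex ha (w := (μ : ℂ) + ((2 * Real.pi * ξ : ℝ) : ℂ) * I)
      (by simpa using hμ), ← integral_indicator measurableSet_Ioi]
  congr 1
  ext t
  by_cases ht : t ∈ Ioi (0 : ℝ)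
  · rw [gammaFun, indicator_of_mem ht, indicator_of_mem ht, smul_eq_mul, mul_left_comm, ← exp_add]
    congr 2
    push_cast
    ring
  · rw [gammaFun, indicator_of_notMem ht, indicator_of_notMem ht, smul_zero]

theorem continuousAt_gammaFun (a : ℂ) (μ : ℝ) {R : ℝ} (hR : 0 < R) :
    ContinuousAt (gammaFun a μ) R := by
  have h1 : ContinuousAt (fun t : ℝ => (t : ℂ) ^ (a - 1) * exp (-((μ : ℂ) * t))) R :=
    (continuousAt_ofReal_cpow_const R (a - 1) (Or.inr hR.ne')).mul (by fun_prop)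
  refine h1.congr ?_
  filter_upwards [lt_mem_nhds hR] with t ht
  rw [gammaFun, indicator_of_mem (show t ∈ Ioi 0 from ht)]

theorem gammaFun_ofReal (S μ : ℝ) (hS : 1 < S) (t : ℝ) :
    gammaFun S μ t = ((max t 0 ^ (S - 1) * Real.exp (-(μ * max t 0)) : ℝ) : ℂ) := by
  by_cases ht : 0 < t
  · rw [gammaFun, indicator_of_mem (show t ∈ Ioi 0 from ht), max_eq_left ht.le]
    push_cast
    rw [ofReal_cpow ht.le]
    push_cast
    rfl
  · rw [gammaFun, indicator_of_notMem (show t ∉ Ioi 0 from ht), max_eq_right (not_lt.mp ht),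
      Real.zero_rpow (by linarith)]
    simp

theorem continuous_gammaFun {S : ℝ} (hS : 1 < S) (μ : ℝ) : Continuous (gammaFun S μ) := by
  rw [funext (gammaFun_ofReal S μ hS)]
  refine continuous_ofReal.comp (Continuous.mul ?_ (by fun_prop))
  exact (continuous_id.max continuous_const).rpow_const fun _ => Or.inr (by linarith)

theorem bddAbove_gammaFun {S : ℝ} (hS : 1 < S) {μ : ℝ} (hμ : 0 < μ) :
    BddAbove (range fun t => ‖gammaFun S μ t‖) := by
  set p := S - 1 with hp
  have hp0 : 0 < p := by linarith
  refine ⟨(p / μ) ^ p, ?_⟩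
  rintro _ ⟨t, rfl⟩
  simp only
  rw [gammaFun_ofReal S μ hS, norm_real, ← hp, Real.norm_eq_abs]
  set u := max t 0 with hu
  have hu0 : 0 ≤ u := le_max_right _ _
  rw [abs_of_nonneg (by positivity)]
  have h1 : μ * u / p ≤ Real.exp (μ * u / p) := by linarith [Real.add_one_le_exp (μ * u / p)]
  have h2 : (μ * u / p) ^ p ≤ Real.exp (μ * u) := by
    calc (μ * u / p) ^ p ≤ (Real.exp (μ * u / p)) ^ p :=
          Real.rpow_le_rpow (by positivity) h1 hp0.le
      _ = Real.exp (μ * u) := by rw [← Real.exp_mul]; congr 1; field_simp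
  have h3 : u ^ p = (p / μ) ^ p * (μ * u / p) ^ p := by
    rw [← Real.mul_rpow (by positivity) (by positivity)]; congr 1; field_simp
  rw [h3, Real.exp_neg, mul_assoc]
  refine mul_le_of_le_one_right (by positivity) ?_
  rw [← div_eq_mul_inv]
  exact div_le_one_of_le₀ h2 (Real.exp_pos _).le

theorem fourier_inversion_scaled {f Φ : ℝ → ℂ} {R : ℝ} (hf : Integrable f)
    (hR : ContinuousAt f R) (hΦ : Integrable Φ) (hfΦ : ∀ ξ, 𝓕 f ξ = Φ (2 * Real.pi * ξ)) :
    f R = 1 / (2 * (Real.pi : ℂ)) * ∫ y : ℝ, exp ((R * y : ℝ) * I) * Φ y := by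
  have hpi : (2 * Real.pi) ≠ 0 := by positivity
  have h1 : Integrable (𝓕 f) := by
    rw [funext hfΦ]
    exact hΦ.comp_mul_left' hpi
  rw [← hf.fourierInv_fourier_eq h1 hR, Real.fourierInv_eq']
  have h2 := Measure.integral_comp_mul_left (fun y : ℝ => exp ((R * y : ℝ) * I) * Φ y)
    (2 * Real.pi)
  rw [abs_of_pos (by positivity), real_smul] at h2
  have h3 : ((2 * Real.pi)⁻¹ : ℝ) = 1 / (2 * (Real.pi : ℂ)) := by push_cast; rw [one_div]
  rw [← h3, ← h2]
  congr 1
  ext ξ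
  rw [hfΦ, smul_eq_mul]
  congr 3
  simp
  ring

theorem exp_mul_kernel (a : ℂ) (S R c y : ℝ) :
    exp ((R * y : ℝ) * I) * kernel a S 0 ((c : ℂ) + (y : ℂ) * I) =
      exp (-(R * c : ℝ)) * kernel a S R ((c : ℂ) + (y : ℂ) * I) := by
  simp only [kernel, ← mul_assoc, ← exp_add]
  congr 3
  push_cast
  ring

theorem vertical_sub_one (c y : ℝ) :
    (c : ℂ) + (y : ℂ) * I - 1 = ((c - 1 : ℝ) : ℂ) + (y : ℂ) * I := by
  push_cast; ring

/-- On the vertical line the loop integral is an inverse Fourier integral; the factor `exp (R * c)`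
undoes the exponential damping built into `f`. -/
theorem loopKernel_eq_of_fourier {ε c : ℝ} (hε : 0 < ε) (hc : 1 < c) {a : ℂ} (ha : 0 ≤ a.re)
    {S : ℝ} (hS : 0 ≤ S) (haS : 1 < a.re + S) {R : ℝ} (hR : 0 < R) {f : ℝ → ℂ} {k : ℂ}
    (hf : Integrable f) (hfR : ContinuousAt f R)
    (hfk : ∀ ξ : ℝ, 𝓕 f ξ = k * kernel a S 0 ((c : ℂ) + ((2 * Real.pi * ξ : ℝ) : ℂ) * I)) :
    k * loopKernel ε c a S R = exp ((R * c : ℝ)) * f R := by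
  rw [fourier_inversion_scaled hf hfR ((integrable_kernel_vertical hc ha hS haS 0).const_mul k) hfk,
    loopKernel_eq_vertical hε hc ha hS haS hR]
  have : ∀ y : ℝ, exp ((R * y : ℝ) * I) * (k * kernel a S 0 ((c : ℂ) + (y : ℂ) * I)) =
      (k * exp (-(R * c : ℝ))) * kernel a S R ((c : ℂ) + (y : ℂ) * I) := fun y => by
    rw [mul_left_comm, exp_mul_kernel, mul_assoc]
  simp only [this]
  rw [integral_const_mul, exp_neg]
  have := exp_ne_zero ((R * c : ℝ) : ℂ)
  generalize (∫ y : ℝ, kernel a S R ((c : ℂ) + (y : ℂ) * I)) = J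
  field_simp

theorem loopKernel_zero_of_one_lt_re {ε c : ℝ} (hε : 0 < ε) (hc : 1 < c) {a : ℂ} (ha : 1 < a.re)
    {R : ℝ} (hR : 0 < R) :
    Gamma a * loopKernel ε c a 0 R = (R : ℂ) ^ (a - 1) * exp R := by
  have ha0 : 0 < a.re := by linarith
  rw [loopKernel_eq_of_fourier hε hc ha0.le le_rfl (by simpa using ha) hR
    (integrable_gammaFun ha0 (sub_pos.mpr hc)) (continuousAt_gammaFun a (c - 1) hR) (fun ξ => by
      rw [fourier_gammaFun ha0 (sub_pos.mpr hc), kernel, vertical_sub_one]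
      simp)]
  rw [gammaFun, indicator_of_mem (show R ∈ Ioi 0 from hR), mul_left_comm, ← exp_add]
  congr 2
  push_cast
  ring

theorem loopKernel_zero {ε c : ℝ} (hε : 0 < ε) (hc : 1 < c) {a : ℂ} (ha : 0 < a.re)
    {R : ℝ} (hR : 0 < R) :
    Gamma a * loopKernel ε c a 0 R = (R : ℂ) ^ (a - 1) * exp R := by
  have ha0 : a ≠ 0 := by rintro rfl; simp at ha
  have hRc : (R : ℂ) ≠ 0 := by exact_mod_cast hR.ne'
  have h1 := loopKernel_zero_of_one_lt_re hε hc (a := a + 1) (by simpa using ha) hR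
  have h2 := loopKernel_zero_recursion hε hc ha hR
  rw [Gamma_add_one a ha0, add_sub_cancel_right] at h1
  rw [cpow_sub _ _ hRc, cpow_one]
  field_simp
  linear_combination Gamma a * h2 + h1

/-- The two powers in the kernel are Fourier transforms of Gamma densities with dampings `c - 1` and
`c`, so their product is that of the convolution. At `s` and `R - s` the dampings combine with `exp
(R * c)` to leave `exp s`. -/
theorem loopKernel_eq_integral {ε c : ℝ} (hε : 0 < ε) (hc : 1 < c) {a : ℂ} (ha : 0 < a.re)
    {S : ℝ} (hS : 1 < S) {R : ℝ} (hR : 0 < R) :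
    Gamma a * Gamma S * loopKernel ε c a S R =
      ∫ s in (0 : ℝ)..R, (s : ℂ) ^ (a - 1) * exp s * (((R - s : ℝ) : ℂ) ^ ((S : ℂ) - 1)) := by
  have hc0 : 0 < c := by linarith
  have hS0 : 0 < ((S : ℂ)).re := by simp; linarith
  have hi1 := integrable_gammaFun ha (sub_pos.mpr hc)
  have hi2 := integrable_gammaFun hS0 hc0
  rw [loopKernel_eq_of_fourier hε hc ha.le (by linarith) (by linarith) hR
    (hi1.integrable_convolution (ContinuousLinearMap.mul ℂ ℂ) hi2)
    (BddAbove.continuous_convolution_right_of_integrable _ (bddAbove_gammaFun hS hc0) hi1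
      (continuous_gammaFun hS c)).continuousAt (fun ξ => by
      rw [Real.fourier_mul_convolution_eq hi1 hi2, fourier_gammaFun ha (sub_pos.mpr hc),
        fourier_gammaFun hS0 hc0, kernel, vertical_sub_one]
      simp
      ring)]
  rw [convolution_def, intervalIntegral.integral_of_le hR.le, integral_Ioc_eq_integral_Ioo,
    ← integral_indicator measurableSet_Ioo, ← integral_const_mul]
  congr 1
  ext s
  rw [ContinuousLinearMap.mul_apply']
  by_cases hs : s ∈ Ioo 0 R
  · rw [indicator_of_mem hs, gammaFun, gammaFun, indicator_of_mem (show s ∈ Ioi 0 from hs.1),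
      indicator_of_mem (show R - s ∈ Ioi 0 from sub_pos.mpr hs.2)]
    have : exp s = exp ((R * c : ℝ)) * exp (-(((c - 1 : ℝ) : ℂ) * s)) *
        exp (-((c : ℂ) * ((R - s : ℝ) : ℂ))) := by
      rw [← exp_add, ← exp_add]; congr 1; push_cast; ring
    rw [this]
    ring
  · rw [indicator_of_notMem hs]
    by_cases hs0 : 0 < s
    · have : R - s ∉ Ioi (0 : ℝ) := fun h => hs ⟨hs0, sub_pos.mp h⟩
      rw [gammaFun, gammaFun, indicator_of_notMem this, mul_zero, mul_zero]
    · rw [gammaFun, indicator_of_notMem (show s ∉ Ioi 0 from hs0), zero_mul, mul_zero]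

end ErlangA

end

/-! ### Growth and non-vanishing of the loop kernel along `S + k`. -/

noncomputable section

namespace ErlangA

open Filter MeasureTheory Set Complex

/-- The weight `s ^ (a - 1) exp s (R - s) ^ (S - 1)` on `[0, R]`. -/
def betaWeight (a : ℂ) (S R : ℝ) (s : ℝ) : ℂ :=
  (s : ℂ) ^ (a - 1) * exp s * (((R - s : ℝ) : ℂ) ^ ((S : ℂ) - 1))

theorem intervalIntegrable_betaWeight {a : ℂ} (ha : 0 < a.re) {S : ℝ} (hS : 1 < S) (R : ℝ) :
    IntervalIntegrable (betaWeight a S R) volume 0 R := by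
  have h1 : IntervalIntegrable (fun s : ℝ => (s : ℂ) ^ (a - 1)) volume 0 R :=
    intervalIntegral.intervalIntegrable_cpow' (by simpa using ha)
  have h2 : Continuous fun s : ℝ => ((R - s : ℝ) : ℂ) ^ ((S : ℂ) - 1) :=
    (continuous_ofReal_cpow_const (y := (S : ℂ) - 1) (by simpa using hS)).comp
      (continuous_const.sub continuous_id)
  exact (h1.mul_continuousOn (g := fun s : ℝ => exp s) (by fun_prop)).mul_continuousOn
    h2.continuousOn

theorem loopKernel_add_nat_eq_integral {ε c : ℝ} (hε : 0 < ε) (hc : 1 < c) {a : ℂ}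
    (ha : 0 < a.re) {S : ℝ} (hS : 1 < S) {R : ℝ} (hR : 0 < R) (k : ℕ) :
    Gamma a * Gamma ((S + k : ℝ)) * loopKernel ε c a (S + k) R =
      ∫ s in (0 : ℝ)..R, betaWeight a S R s * ((R - s : ℝ) : ℂ) ^ k := by
  have hSk : 1 < S + k := by
    have : (0 : ℝ) ≤ k := by positivity
    linarith
  rw [loopKernel_eq_integral hε hc ha hSk hR]
  refine intervalIntegral.integral_congr_ae ?_
  have hne : ∀ᵐ s : ℝ ∂volume, s ≠ R := by simp [ae_iff]
  filter_upwards [hne] with s hs _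
  have : ((R - s : ℝ) : ℂ) ≠ 0 := by exact_mod_cast sub_ne_zero.mpr hs.symm
  rw [betaWeight, show ((S + k : ℝ) : ℂ) - 1 = ((S : ℂ) - 1) + k by push_cast; ring,
    cpow_add _ _ this, cpow_natCast]
  ring

theorem norm_Gamma_mul_loopKernel_le {ε c : ℝ} (hε : 0 < ε) (hc : 1 < c) {a : ℂ}
    (ha : 0 < a.re) {S : ℝ} (hS : 1 < S) {R : ℝ} (hR : 0 < R) :
    ∃ C : ℝ, ∀ k : ℕ, ‖Gamma ((S + k : ℝ)) * loopKernel ε c a (S + k) R‖ ≤ C * R ^ k := by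
  refine ⟨‖Gamma a‖⁻¹ * ∫ s in (0 : ℝ)..R, ‖betaWeight a S R s‖, fun k => ?_⟩
  have hΓ : 0 < ‖Gamma a‖ := norm_pos_iff.mpr (Gamma_ne_zero_of_re_pos ha)
  have h1 := loopKernel_add_nat_eq_integral hε hc ha hS hR k
  have h2 : ‖∫ s in (0 : ℝ)..R, betaWeight a S R s * ((R - s : ℝ) : ℂ) ^ k‖ ≤
      ∫ s in (0 : ℝ)..R, ‖betaWeight a S R s‖ * R ^ k := by
    refine intervalIntegral.norm_integral_le_of_norm_le hR.le (Eventually.of_forall fun s hs => ?_)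
      ((intervalIntegrable_betaWeight ha hS R).norm.mul_const _)
    rw [norm_mul, norm_pow, norm_real, Real.norm_eq_abs, abs_of_nonneg (by linarith [hs.2])]
    gcongr
    · linarith [hs.2]
    · linarith [hs.1]
  rw [← h1, mul_assoc, norm_mul, intervalIntegral.integral_mul_const] at h2
  rw [mul_assoc, ← div_eq_inv_mul, le_div_iff₀ hΓ]
  linarith

theorem betaIntegral_ne_zero {u v : ℂ} (hu : 0 < u.re) (hv : 0 < v.re) :
    betaIntegral u v ≠ 0 := fun h => by
  have := Gamma_mul_Gamma_eq_betaIntegral hu hv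
  rw [h, mul_zero] at this
  exact mul_ne_zero (Gamma_ne_zero_of_re_pos hu) (Gamma_ne_zero_of_re_pos hv) this

/-- Summing `(R - s) ^ k / k!` produces `exp (R - s)`, which cancels the `exp s` in the weight and
leaves a Beta integral. -/
theorem hasSum_integral_betaWeight {a : ℂ} (ha : 0 < a.re) {S : ℝ} (hS : 1 < S) {R : ℝ}
    (hR : 0 < R) :
    HasSum (fun k : ℕ => (k.factorial : ℂ)⁻¹ *
        ∫ s in (0 : ℝ)..R, betaWeight a S R s * ((R - s : ℝ) : ℂ) ^ k)
      (exp R * ((R : ℂ) ^ (a + S - 1) * betaIntegral a S)) := by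
  have hint := intervalIntegrable_betaWeight ha hS R
  rw [← betaIntegral_scaled a S hR, ← intervalIntegral.integral_const_mul]
  simp only [← intervalIntegral.integral_const_mul]
  have hsum : ∀ x : ℝ, HasSum (fun k : ℕ => (k.factorial : ℝ)⁻¹ * x ^ k) (Real.exp x) := by
    intro x
    rw [Real.exp_eq_exp_ℝ]
    simpa [div_eq_inv_mul] using NormedSpace.expSeries_div_hasSum_exp (𝔸 := ℝ) x
  have hsumc : ∀ x : ℂ, HasSum (fun k : ℕ => (k.factorial : ℂ)⁻¹ * x ^ k) (exp x) := by
    intro x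
    rw [exp_eq_exp_ℂ]
    simpa [div_eq_inv_mul] using NormedSpace.expSeries_div_hasSum_exp (𝔸 := ℂ) x
  refine intervalIntegral.hasSum_integral_of_dominated_convergence
    (fun (k : ℕ) s => ‖betaWeight a S R s‖ * ((k.factorial : ℝ)⁻¹ * R ^ k)) ?_ ?_ ?_ ?_ ?_
  · intro k
    have : IntervalIntegrable (fun s : ℝ => (k.factorial : ℂ)⁻¹ *
        (betaWeight a S R s * ((R - s : ℝ) : ℂ) ^ k)) volume 0 R :=
      (hint.mul_continuousOn (g := fun s : ℝ => ((R - s : ℝ) : ℂ) ^ k) (by fun_prop)).const_mul _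
    exact this.def'.aestronglyMeasurable
  · intro k
    filter_upwards with s hs
    rw [uIoc_of_le hR.le] at hs
    rw [norm_mul, norm_mul, norm_pow, norm_real, Real.norm_eq_abs,
      abs_of_nonneg (by linarith [hs.2]), mul_left_comm, norm_inv, norm_natCast]
    gcongr
    · linarith [hs.2]
    · linarith [hs.1]
  · exact Eventually.of_forall fun s _ => (hsum R).summable.mul_left _
  · simp only [tsum_mul_left, (hsum R).tsum_eq]
    exact hint.norm.mul_const _
  · refine Eventually.of_forall fun s _ => ?_
    have h1 := (hsumc ((R - s : ℝ) : ℂ)).mul_left (betaWeight a S R s)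
    have h2 : betaWeight a S R s * exp ((R - s : ℝ) : ℂ) =
        exp R * ((s : ℂ) ^ (a - 1) * ((R : ℂ) - s) ^ ((S : ℂ) - 1)) := by
      have : exp (R : ℂ) = exp s * exp ((R - s : ℝ) : ℂ) := by
        rw [← exp_add]; congr 1; push_cast; ring
      rw [this, betaWeight]
      push_cast
      ring
    rw [h2] at h1
    convert! h1 using 1
    ext k
    ring

/-- The weight is complex-valued, so positivity is not available; instead, if all moments vanished,
so would their sum, a nonzero multiple of a Beta value. -/
theorem exists_loopKernel_add_nat_ne_zero {ε c : ℝ} (hε : 0 < ε) (hc : 1 < c) {a : ℂ}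
    (ha : 0 < a.re) {S : ℝ} (hS : 1 < S) {R : ℝ} (hR : 0 < R) :
    ∃ k : ℕ, loopKernel ε c a (S + k) R ≠ 0 := by
  by_contra! h
  have h1 := hasSum_integral_betaWeight ha hS hR
  simp only [← loopKernel_add_nat_eq_integral hε hc ha hS hR, h, mul_zero] at h1
  have h2 := h1.unique hasSum_zero
  have hRc : (R : ℂ) ≠ 0 := by exact_mod_cast hR.ne'
  refine mul_ne_zero (exp_ne_zero _) (mul_ne_zero ?_ (betaIntegral_ne_zero ha ?_)) h2
  · simp [cpow_eq_zero_iff, hRc]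
  · simp; linarith

end ErlangA

end

/-! ### The circle integrals `F`: initial values and recursion. -/

noncomputable section

namespace ErlangA

open Filter MeasureTheory Set Complex

/-- The integrand of `F`. -/
def circleKernel (ρ : ℝ) (n : ℤ) (θ z : ℂ) : ℂ :=
  exp ((ρ : ℂ) * z) / (z ^ (n + 1) * (1 - z) ^ θ)

theorem one_sub_mem_slitPlane {z : ℂ} (hz : ‖z‖ < 1) : 1 - z ∈ slitPlane := by
  refine Or.inl ?_
  have := re_le_norm z
  simp; linarith

theorem differentiableAt_exp_mul_one_sub_cpow (ρ : ℝ) (θ : ℂ) {z : ℂ} (hz : ‖z‖ < 1) :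
    DifferentiableAt ℂ (fun z : ℂ => exp ((ρ : ℂ) * z) * (1 - z) ^ (-θ)) z := by
  refine DifferentiableAt.mul (by fun_prop) ?_
  exact DifferentiableAt.cpow_const (by fun_prop) (one_sub_mem_slitPlane hz)

theorem differentiableOn_exp_mul_one_sub_cpow (ρ : ℝ) (θ : ℂ) {r : ℝ} (hr1 : r < 1) :
    DifferentiableOn ℂ (fun z : ℂ => exp ((ρ : ℂ) * z) * (1 - z) ^ (-θ))
      (Metric.closedBall 0 r) := fun _ hz =>
  (differentiableAt_exp_mul_one_sub_cpow ρ θ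
    ((mem_closedBall_zero_iff.mp hz).trans_lt hr1)).differentiableWithinAt

theorem F_zero {r : ℝ} (hr : 0 < r) (hr1 : r < 1) (ρ : ℝ) (θ : ℂ) : F r ρ 0 θ = 1 := by
  have h1 := (differentiableOn_exp_mul_one_sub_cpow ρ θ hr1).circleIntegral_sub_inv_smul
    (w := 0) (by simpa using hr)
  have h2 : (∮ z in C(0, r), exp ((ρ : ℂ) * z) / (z ^ ((0 : ℤ) + 1) * (1 - z) ^ θ)) =
      ∮ z in C(0, r), (z - 0)⁻¹ • (exp ((ρ : ℂ) * z) * (1 - z) ^ (-θ)) := by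
    refine circleIntegral.integral_congr hr.le fun z _ => ?_
    simp only [cpow_neg, sub_zero, smul_eq_mul, zero_add, zpow_one, div_eq_mul_inv, mul_inv]
    ring
  rw [F, h2, h1]
  simp only [smul_eq_mul, mul_zero, exp_zero, sub_zero, one_cpow, mul_one]
  exact one_div_mul_cancel two_pi_I_ne_zero

theorem F_neg_one {r : ℝ} (hr : 0 < r) (hr1 : r < 1) (ρ : ℝ) (θ : ℂ) : F r ρ (-1) θ = 0 := by
  have h1 := ((differentiableOn_exp_mul_one_sub_cpow ρ θ hr1).mono
    Metric.closure_ball_subset_closedBall).diffContOnCl.circleIntegral_eq_zero hr.le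
  have h2 : (∮ z in C(0, r), exp ((ρ : ℂ) * z) / (z ^ ((-1 : ℤ) + 1) * (1 - z) ^ θ)) =
      ∮ z in C(0, r), (exp ((ρ : ℂ) * z) * (1 - z) ^ (-θ)) := by
    refine circleIntegral.integral_congr hr.le fun z _ => ?_
    simp [cpow_neg, div_eq_mul_inv]
  rw [F, h2, h1, mul_zero]

theorem hasDerivAt_circleKernel (ρ : ℝ) (n : ℤ) (θ : ℂ) {z : ℂ} (hz0 : z ≠ 0) (hz : ‖z‖ < 1) :
    HasDerivAt (fun z : ℂ => exp ((ρ : ℂ) * z) * (1 - z) ^ (1 - θ) * z ^ (-(n + 1)))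
      ((ρ + θ + n) * circleKernel ρ n θ z - (ρ * circleKernel ρ (n - 1) θ z +
        (n + 1) * circleKernel ρ (n + 1) θ z)) z := by
  have hs := one_sub_mem_slitPlane hz
  have hs0 := slitPlane_ne_zero hs
  have h1 : HasDerivAt (fun z : ℂ => exp ((ρ : ℂ) * z)) (exp (ρ * z) * ρ) z := by
    simpa using ((hasDerivAt_id z).const_mul (ρ : ℂ)).cexp
  have h2 : HasDerivAt (fun z : ℂ => (1 - z) ^ (1 - θ)) ((1 - θ) * (1 - z) ^ (1 - θ - 1) * (-1)) z :=
    ((hasDerivAt_id z).const_sub 1).cpow_const hs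
  have h3 := hasDerivAt_zpow (-(n + 1)) z (Or.inl hz0)
  convert! (h1.mul h2).mul h3 using 1
  simp only [circleKernel, Pi.mul_apply]
  have e1 : (1 - z) ^ (1 - θ) = (1 - z) * ((1 - z) ^ θ)⁻¹ := by
    rw [cpow_sub _ _ hs0, cpow_one, div_eq_mul_inv]
  have e2 : (1 - z) ^ (1 - θ - 1) = ((1 - z) ^ θ)⁻¹ := by
    rw [show 1 - θ - 1 = -θ by ring, cpow_neg]
  have e3 : z ^ (-(n + 1)) = (z ^ n)⁻¹ * z⁻¹ := by
    rw [zpow_neg, zpow_add₀ hz0, zpow_one, mul_inv]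
  have e4 : z ^ (-(n + 1) - 1) = (z ^ n)⁻¹ * z⁻¹ * z⁻¹ := by
    rw [zpow_sub₀ hz0, e3, zpow_one]; ring
  have e5 : z ^ (n + 1) = z ^ n * z := by rw [zpow_add₀ hz0, zpow_one]
  have e6 : z ^ (n + 1 + 1) = z ^ n * z * z := by rw [zpow_add₀ hz0, zpow_one, e5]
  have e7 : z ^ (n - 1 + 1) = z ^ n := by rw [sub_add_cancel]
  have hθ : (1 - z) ^ θ ≠ 0 := by simp [cpow_eq_zero_iff, hs0]
  have hzn : z ^ n ≠ 0 := zpow_ne_zero n hz0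
  rw [e1, e2, e3, e4, e5, e6, e7]
  push_cast
  field_simp
  ring

theorem circleIntegrable_circleKernel {r : ℝ} (hr : 0 < r) (hr1 : r < 1) (ρ : ℝ) (n : ℤ) (θ : ℂ) :
    CircleIntegrable (circleKernel ρ n θ) 0 r := by
  refine ContinuousOn.circleIntegrable hr.le fun z hz => ContinuousAt.continuousWithinAt ?_
  have hzr : ‖z‖ = r := by simpa using hz
  have hz0 : z ≠ 0 := norm_pos_iff.mp (by linarith)
  have hs := one_sub_mem_slitPlane (z := z) (by linarith)
  have hθ : (1 - z) ^ θ ≠ 0 := by simp [cpow_eq_zero_iff, slitPlane_ne_zero hs]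
  refine ContinuousAt.div (by fun_prop) ?_ (mul_ne_zero (zpow_ne_zero _ hz0) hθ)
  refine (continuousAt_zpow₀ _ _ (Or.inl hz0)).mul ?_
  exact (DifferentiableAt.cpow_const (by fun_prop) hs).continuousAt

theorem F_recursion {r : ℝ} (hr : 0 < r) (hr1 : r < 1) (ρ : ℝ) (n : ℤ) (θ : ℂ) :
    ρ * F r ρ (n - 1) θ - (ρ + θ + n) * F r ρ n θ + (n + 1) * F r ρ (n + 1) θ = 0 := by
  have hi : ∀ (k : ℤ) (w : ℂ), CircleIntegrable (fun z => w * circleKernel ρ k θ z) 0 r :=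
    fun k w => (circleIntegrable_circleKernel hr hr1 ρ k θ).const_smul (a := w)
  have hadd : ∀ (k l : ℤ) (w v : ℂ), CircleIntegrable
      (fun z => w * circleKernel ρ k θ z + v * circleKernel ρ l θ z) 0 r :=
    fun k l w v => (hi k w).add (hi l v)
  have h0 := circleIntegral.integral_eq_zero_of_hasDerivWithinAt hr.le
    (c := 0) (fun z hz => by
      have hzr : ‖z‖ = r := by simpa using hz
      exact (hasDerivAt_circleKernel ρ n θ (norm_pos_iff.mp (by linarith))
        (by linarith)).hasDerivWithinAt)
  rw [circleIntegral.integral_sub (hi _ _) (hadd _ _ _ _),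
    circleIntegral.integral_add (hi _ _) (hi _ _),
    circleIntegral.integral_const_mul, circleIntegral.integral_const_mul,
    circleIntegral.integral_const_mul] at h0
  simp only [circleKernel] at h0
  simp only [F]
  linear_combination -(1 / (2 * (Real.pi : ℂ) * I)) * h0

end ErlangA

end

/-! ### Forward equations for `G` and `H`, reversible weights, Wronskians and the queue's rates. -/

noncomputable section

namespace ErlangA

open Filter MeasureTheory Set Complex

section Contour

variable {ε c ρ η : ℝ} {θ : ℂ}

theorem G_eq_loopKernel (hε : 0 < ε) (hc : 1 < c) (n : ℤ) (θ : ℂ) :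
    G ε c ρ n θ = loopKernel ε c θ ((n + 1 : ℤ) : ℝ) ρ := by
  rw [G, loopKernel]
  congr 1
  refine loopIntegral_congr hε hc fun z _ => ?_
  simp only [kernel]
  rw [cpow_neg, cpow_neg, ofReal_intCast, cpow_intCast, div_eq_mul_inv, mul_inv]
  ring

theorem H_eq_loopKernel (hε : 0 < ε) (hc : 1 < c) (m : ℕ) (n : ℤ) (θ : ℂ) :
    H ε c ρ η m n θ = loopKernel ε c (θ / η) (((n + 1 - m : ℤ) : ℝ) + m / η) (ρ / η) := by
  rw [H, loopKernel]
  congr 1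
  refine loopIntegral_congr hε hc fun z hz => ?_
  have hz0 := slitPlane_ne_zero (mem_slitPlane_of_mem_slitDomain hz)
  simp only [kernel]
  rw [cpow_neg, cpow_neg, ofReal_add, cpow_add _ _ hz0, ofReal_intCast, cpow_intCast,
    div_eq_mul_inv, mul_inv, mul_inv]
  push_cast
  rw [mul_div_right_comm]
  ring

theorem G_recursion (hε : 0 < ε) (hc : 1 < c) (hρ : 0 < ρ) (hθ : 0 < θ.re) (n : ℕ) :
    ρ * G ε c ρ (n - 1) θ - (ρ + θ + n) * G ε c ρ n θ + (n + 1) * G ε c ρ (n + 1) θ = 0 := by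
  have h := loopKernel_recursion hε hc hθ (S := n) (by positivity) hρ
  simp only [G_eq_loopKernel hε hc]
  push_cast
  rw [sub_add_cancel, add_assoc (n : ℝ) 1 1, one_add_one_eq_two]
  exact_mod_cast h

theorem G_neg_one (hε : 0 < ε) (hc : 1 < c) (hρ : 0 < ρ) (hθ : 0 < θ.re) :
    Gamma θ * G ε c ρ (-1) θ = (ρ : ℂ) ^ (θ - 1) * exp ρ := by
  rw [G_eq_loopKernel hε hc, ← loopKernel_zero hε hc hθ hρ]
  simp

theorem H_recursion (hε : 0 < ε) (hc : 1 < c) (hρ : 0 < ρ) (hη : 0 < η) (hθ : 0 < θ.re)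
    (m k : ℕ) :
    ρ * H ε c ρ η m (m + k - 1) θ - (ρ + θ + (m + k * η)) * H ε c ρ η m (m + k) θ +
      (m + (k + 1) * η) * H ε c ρ η m (m + k + 1) θ = 0 := by
  have hη' : (η : ℂ) ≠ 0 := by exact_mod_cast hη.ne'
  have hθη : 0 < (θ / η).re := by rw [div_ofReal_re]; positivity
  have h := loopKernel_recursion hε hc hθη (S := k + m / η) (by positivity) (div_pos hρ hη)
  simp only [H_eq_loopKernel hε hc]
  push_cast
  rw [show ((m : ℝ) + k - 1 + 1 - m + m / η) = k + m / η by ring,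
    show ((m : ℝ) + k + 1 - m + m / η) = k + m / η + 1 by ring,
    show ((m : ℝ) + k + 1 + 1 - m + m / η) = k + m / η + 2 by ring]
  push_cast at h
  generalize loopKernel ε c (θ / η) (k + m / η) (ρ / η) = A at h ⊢
  generalize loopKernel ε c (θ / η) (k + m / η + 1) (ρ / η) = B at h ⊢
  generalize loopKernel ε c (θ / η) (k + m / η + 2) (ρ / η) = C at h ⊢
  field_simp at h
  linear_combination h

theorem H_eq_loopKernel_add (hε : 0 < ε) (hc : 1 < c) (m k : ℕ) (θ : ℂ) :
    H ε c ρ η m (m + k) θ = loopKernel ε c (θ / η) (1 + m / η + k) (ρ / η) := by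
  rw [H_eq_loopKernel hε hc]
  congr 1
  push_cast
  ring

end Contour

/-- The reciprocal `∏ d (j + 1) / ρ ^ n` of the reversible weight of the state `n`. -/
def recipWeight (ρ : ℝ) (d : ℕ → ℝ) (n : ℕ) : ℝ := ∏ j ∈ Finset.range n, d (j + 1) / ρ

theorem recipWeight_succ (ρ : ℝ) (d : ℕ → ℝ) (n : ℕ) :
    recipWeight ρ d (n + 1) = recipWeight ρ d n * (d (n + 1) / ρ) :=
  Finset.prod_range_succ _ _

theorem recipWeight_pos {ρ : ℝ} (hρ : 0 < ρ) {d : ℕ → ℝ} (hd : ∀ i, 0 < d (i + 1)) (n : ℕ) :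
    0 < recipWeight ρ d n :=
  Finset.prod_pos fun i _ => div_pos (hd i) hρ

/-- Detailed balance: dividing a forward solution by the reversible weight gives a backward
solution. -/
theorem backwardEq_of_forward {ρ : ℝ} (hρ : 0 < ρ) {d : ℕ → ℝ} {θ : ℂ} {X x : ℕ → ℂ} {i : ℕ}
    (hx0 : x i = X i * recipWeight ρ d i)
    (hx1 : x (i + 1) = X (i + 1) * recipWeight ρ d (i + 1))
    (hx2 : x (i + 2) = X (i + 2) * recipWeight ρ d (i + 2))
    (h : ρ * X i - (ρ + θ + d (i + 1)) * X (i + 1) + d (i + 2) * X (i + 2) = 0) :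
    BackwardEq ρ d θ x (i + 1) := by
  have hρ' : (ρ : ℂ) ≠ 0 := by exact_mod_cast hρ.ne'
  have e2 := recipWeight_succ ρ d (i + 1)
  have e1 := recipWeight_succ ρ d i
  simp only [BackwardEq, Nat.add_sub_cancel]
  rw [hx0, hx1, hx2, show i + 2 = i + 1 + 1 from rfl, e2, e1]
  push_cast
  field_simp
  linear_combination -(recipWeight ρ d i : ℂ) * (d (i + 1) : ℂ) * h

theorem BackwardEq.succ_eq {ρ : ℝ} (hρ : 0 < ρ) {d : ℕ → ℝ} {θ : ℂ} {v : ℕ → ℂ} {i : ℕ}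
    (h : BackwardEq ρ d θ v i) : v (i + 1) = ((θ + ρ + d i) * v i - d i * v (i - 1)) / ρ := by
  have hρ' : (ρ : ℂ) ≠ 0 := by exact_mod_cast hρ.ne'
  rw [eq_div_iff hρ', h]
  ring

/-- The solution of the backward equations that takes the value one at zero. -/
def regularSolution (ρ : ℝ) (d : ℕ → ℝ) (θ : ℂ) : ℕ → ℂ
  | 0 => 1
  | 1 => (θ + ρ) / ρ
  | n + 2 => ((θ + ρ + d (n + 1)) * regularSolution ρ d θ (n + 1) -
      d (n + 1) * regularSolution ρ d θ n) / ρ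

theorem backwardEq_regularSolution {ρ : ℝ} (hρ : 0 < ρ) {d : ℕ → ℝ} (hd0 : d 0 = 0) (θ : ℂ)
    (i : ℕ) : BackwardEq ρ d θ (regularSolution ρ d θ) i := by
  have hρ' : (ρ : ℂ) ≠ 0 := by exact_mod_cast hρ.ne'
  rcases i with _ | i
  · simp only [BackwardEq, regularSolution, hd0]
    field_simp
    simp
  · simp only [BackwardEq, regularSolution, Nat.add_sub_cancel]
    field_simp
    ring

/-- One initial value suffices: since `0 - 1 = 0` in `ℕ`, the equation at `0` involves only the
values at `0` and `1`. -/
theorem BackwardEq.eq_of_eq_zero {ρ : ℝ} (hρ : 0 < ρ) {d : ℕ → ℝ} {θ : ℂ} {v w : ℕ → ℂ} {m : ℕ}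
    (hv : ∀ i < m, BackwardEq ρ d θ v i) (hw : ∀ i < m, BackwardEq ρ d θ w i) (h0 : v 0 = w 0)
    (i : ℕ) (hi : i ≤ m) : v i = w i := by
  induction i using Nat.strong_induction_on with
  | _ i ih =>
    rcases i with _ | i
    · exact h0
    · rw [(hv i (by omega)).succ_eq hρ, (hw i (by omega)).succ_eq hρ, ih i (by omega) (by omega),
        ih (i - 1) (by omega) (by omega)]

theorem BackwardEq.eq_zero_of_ge {ρ : ℝ} (hρ : 0 < ρ) {d : ℕ → ℝ} {θ : ℂ} {v : ℕ → ℂ} {m : ℕ}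
    (hv : ∀ i, m + 1 ≤ i → BackwardEq ρ d θ v i) (h0 : v m = 0) (h1 : v (m + 1) = 0) (k : ℕ) :
    v (m + k) = 0 := by
  induction k using Nat.strong_induction_on with
  | _ k ih =>
    rcases k with _ | _ | k
    · exact h0
    · exact h1
    · have := (hv (m + k + 1) (by omega)).succ_eq hρ
      rw [Nat.add_sub_cancel, ih k (by omega), show m + k + 1 = m + (k + 1) by ring,
        ih (k + 1) (by omega)] at this
      rw [show m + (k + 1 + 1) = m + (k + 1) + 1 by ring, this]
      simp

theorem exists_norm_le_of_exists_norm_le_ge {v : ℕ → ℂ} {m : ℕ}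
    (h : ∃ B : ℝ, ∀ k, ‖v (m + k)‖ ≤ B) : ∃ B : ℝ, ∀ i, ‖v i‖ ≤ B := by
  obtain ⟨B, hB⟩ := h
  have hB0 : 0 ≤ B := (norm_nonneg _).trans (hB 0)
  refine ⟨∑ k ∈ Finset.range m, ‖v k‖ + B, fun i => ?_⟩
  have hs : 0 ≤ ∑ k ∈ Finset.range m, ‖v k‖ := Finset.sum_nonneg fun _ _ => norm_nonneg _
  by_cases hi : i < m
  · have := Finset.single_le_sum (f := fun k => ‖v k‖) (fun _ _ => norm_nonneg _)
      (Finset.mem_range.mpr hi)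
    linarith
  · obtain ⟨k, rfl⟩ := exists_add_of_le (not_lt.mp hi)
    linarith [hB k]

/-- A nonzero bounded solution on a right half-line is not proportional to a nonzero solution
that is regular at zero. -/
theorem wronskian_ne_zero {ρ : ℝ} (hρ : 0 < ρ) {d : ℕ → ℝ} (hd : ∀ i, 0 ≤ d i) {θ : ℂ}
    (hθ : 0 < θ.re) {x y : ℕ → ℂ} {m : ℕ} (hx : ∀ i, BackwardEq ρ d θ x i)
    (hx0 : x 0 ≠ 0) (hy : ∀ i, m + 1 ≤ i → BackwardEq ρ d θ y i)
    (hyB : ∃ B : ℝ, ∀ k, ‖y (m + k)‖ ≤ B) (hy0 : ∃ k, y (m + k) ≠ 0) :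
    x (m + 1) * y m - x m * y (m + 1) ≠ 0 := by
  intro hw
  have hcomb : ∀ α β : ℂ, α * x m = β * y m → α * x (m + 1) = β * y (m + 1) →
      ∀ k, α * x (m + k) = β * y (m + k) := by
    intro α β h0 h1 k
    refine sub_eq_zero.mp (BackwardEq.eq_zero_of_ge hρ (d := d) (θ := θ)
      (v := fun i => α * x i - β * y i) (fun i hi => ?_) (sub_eq_zero.mpr h0)
      (sub_eq_zero.mpr h1) k)
    have h2 := hx i
    have h3 := hy i hi
    simp only [BackwardEq] at h2 h3 ⊢
    linear_combination α * h2 - β * h3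
  -- A coefficient `α ≠ 0` is needed so that boundedness passes from `y` to `x`; it exists because
  -- `y` cannot vanish at both `m` and `m + 1`.
  obtain ⟨α, β, hα, hαβ⟩ : ∃ α β : ℂ, α ≠ 0 ∧ ∀ k, α * x (m + k) = β * y (m + k) := by
    by_cases h0 : y m = 0
    · by_cases h1 : y (m + 1) = 0
      · obtain ⟨k, hk⟩ := hy0
        exact absurd (BackwardEq.eq_zero_of_ge hρ hy h0 h1 k) hk
      · exact ⟨y (m + 1), x (m + 1), h1, hcomb _ _ (by linear_combination -hw) (by ring)⟩
    · exact ⟨y m, x m, h0, hcomb _ _ (by ring) (by linear_combination hw)⟩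
  obtain ⟨B, hB⟩ := hyB
  obtain ⟨B', hB'⟩ := exists_norm_le_of_exists_norm_le_ge (v := x) (m := m)
    ⟨‖β‖ * B / ‖α‖, fun k => by
      rw [le_div_iff₀ (norm_pos_iff.mpr hα), mul_comm, ← norm_mul, hαβ k, norm_mul]
      gcongr
      exact hB k⟩
  exact hx0 (bounded_solution_eq_zero hρ hd hθ hB' hx 0)

theorem wronskian_eq {ρ : ℝ} (hρ : 0 < ρ) {d : ℕ → ℝ} {θ : ℂ} {x y : ℕ → ℂ}
    (hx : ∀ i, BackwardEq ρ d θ x i) (hy : ∀ i, 1 ≤ i → BackwardEq ρ d θ y i) (n : ℕ) :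
    x (n + 1) * y n - x n * y (n + 1) = (x 1 * y 0 - x 0 * y 1) * recipWeight ρ d n := by
  have hρ' : (ρ : ℂ) ≠ 0 := by exact_mod_cast hρ.ne'
  induction n with
  | zero => simp [recipWeight]
  | succ n ih =>
    have h := wronskian_succ (hx (n + 1)) (hy (n + 1) (by omega))
    rw [ih] at h
    rw [recipWeight_succ]
    push_cast
    field_simp
    linear_combination h

section DeathRate

variable {m : ℕ} {η : ℝ}

theorem deathRate_of_le {j : ℕ} (h : j ≤ m) : deathRate m η j = j := if_pos h

theorem deathRate_add (k : ℕ) : deathRate m η (m + k) = m + k * η := by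
  rcases k with _ | k
  · simp [deathRate]
  · rw [deathRate, if_neg (by omega)]
    push_cast
    ring

theorem deathRate_nonneg (hη : 0 < η) (j : ℕ) : 0 ≤ deathRate m η j := by
  rcases le_total j m with h | h
  · rw [deathRate_of_le h]; positivity
  · obtain ⟨k, rfl⟩ := exists_add_of_le h
    rw [deathRate_add]; positivity

theorem deathRate_succ_pos (hη : 0 < η) (j : ℕ) : 0 < deathRate m η (j + 1) := by
  rcases le_total (j + 1) m with h | h
  · rw [deathRate_of_le h]; positivity
  · obtain ⟨k, hk⟩ := exists_add_of_le h
    rw [hk, deathRate_add]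
    rcases m with _ | m
    · have : 0 < k := by omega
      positivity
    · positivity

theorem deathRate_zero : deathRate m η 0 = 0 := by simp [deathRate]

theorem recipWeight_of_le {ρ : ℝ} {i : ℕ} (hi : i ≤ m) :
    recipWeight ρ (deathRate m η) i = i.factorial / ρ ^ i := by
  induction i with
  | zero => simp [recipWeight]
  | succ i ih =>
    rw [recipWeight_succ, ih (by omega), deathRate_of_le hi, Nat.factorial_succ, pow_succ]
    push_cast
    ring

/-- The Gamma quotient and the power of `ρ / η` are exactly the growth that
`norm_Gamma_mul_loopKernel_le` controls, so weighted `H` is bounded. -/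
theorem recipWeight_add {ρ : ℝ} (hρ : 0 < ρ) (hη : 0 < η) (k : ℕ) :
    recipWeight ρ (deathRate m η) (m + k) = recipWeight ρ (deathRate m η) m *
      (Real.Gamma (1 + m / η + k) / Real.Gamma (1 + m / η) / (ρ / η) ^ k) := by
  have hpos : 0 < 1 + m / η := by positivity
  have hΓ := (Real.Gamma_pos_of_pos hpos).ne'
  induction k with
  | zero => simp [hΓ]
  | succ k ih =>
    have hpos' : 1 + m / η + k ≠ 0 := by positivity
    rw [← add_assoc, recipWeight_succ, ih, add_assoc m k 1, deathRate_add]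
    push_cast
    rw [← add_assoc (1 + m / η), Real.Gamma_add_one hpos', pow_succ]
    field_simp
    ring

theorem sum_generator_mul (ρ : ℝ) (i : ℕ) (v : ℕ → ℂ) :
    ∑ k ∈ Finset.range (i + 2), (generator m ρ η i k : ℂ) * v k =
      ρ * v (i + 1) + deathRate m η i * v (i - 1) - (ρ + deathRate m η i) * v i := by
  rw [Finset.sum_range_succ, Finset.sum_range_succ]
  have e1 : generator m ρ η i (i + 1) = ρ := by simp [generator]
  have e2 : generator m ρ η i i = -(ρ + deathRate m η i) := by simp [generator]
  have e3 : ∑ k ∈ Finset.range i, (generator m ρ η i k : ℂ) * v k =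
      deathRate m η i * v (i - 1) := by
    rcases i with _ | i
    · simp [deathRate_zero]
    · rw [Finset.sum_range_succ, Finset.sum_eq_zero]
      · have : i ≠ i + 1 + 1 := by omega
        simp [generator, this]
      · intro k hk
        have := Finset.mem_range.mp hk
        rw [generator, if_neg (by omega), if_neg (by omega), if_neg (by omega)]
        simp
  rw [e1, e2, e3]
  push_cast
  ring

theorem sum_generator (ρ : ℝ) (i : ℕ) :
    ∑ k ∈ Finset.range (i + 2), generator m ρ η i k = 0 := by
  have := sum_generator_mul (m := m) (η := η) ρ i (fun _ => 1)
  simp only [mul_one] at this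
  have h2 : (((∑ k ∈ Finset.range (i + 2), generator m ρ η i k : ℝ)) : ℂ) = ((0 : ℝ) : ℂ) := by
    push_cast
    rw [this]
    ring
  exact_mod_cast h2

end DeathRate

theorem IsErlangA.exists_transition {Ω : Type*} [MeasurableSpace Ω] {P : Measure Ω}
    [IsProbabilityMeasure P] {N : ℝ≥0 → Ω → ℕ} {m : ℕ} {ρ η : ℝ} (hN : IsErlangA P N m ρ η)
    {n₀ : ℕ} (hinit : P {ω | N 0 ω = n₀} ≠ 0) :
    ∃ p : ℝ≥0 → ℕ → ℕ → ℝ, IsTransitionFunction (generator m ρ η) p ∧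
      ∀ n t, transientProb P N n₀ n t = p t n₀ n := by
  obtain ⟨hmeas, p, hp, hM⟩ := hN
  refine ⟨p, hp, fun n t => ?_⟩
  have h := hM 0 t n₀ n univ MeasurableSet.univ
  rw [univ_inter, zero_add] at h
  have hms : MeasurableSet {ω | N 0 ω = n₀} := hmeas 0 (measurableSet_singleton n₀)
  have h0 : P.real {ω | N 0 ω = n₀} ≠ 0 := by
    rw [measureReal_def, ENNReal.toReal_ne_zero]
    exact ⟨hinit, measure_ne_top _ _⟩
  rw [transientProb, measureReal_def, ProbabilityTheory.cond_apply hms, ENNReal.toReal_mul,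
    ENNReal.toReal_inv, ← measureReal_def, ← measureReal_def, h]
  field_simp

end ErlangA

end

/-! ### Assembly: gluing the contour integrals and reading off the three formulas. -/

theorem theorem1 {Ω : Type*} [MeasurableSpace Ω] (P : MeasureTheory.Measure Ω)
    [MeasureTheory.IsProbabilityMeasure P] (N : NNReal → Ω → ℕ)
    (m : ℕ) (hm : 1 ≤ m) (ρ η : ℝ) (hρ : 0 < ρ) (hη : 0 < η)
    (hN : ErlangA.IsErlangA P N m ρ η)
    (n₀ : ℕ) (hn₀ : n₀ ≤ m) (hinit : P {ω | N 0 ω = n₀} ≠ 0)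
    (θ : ℂ) (hθ : 0 < θ.re)
    (r ε c : ℝ) (hr : 0 < r) (hr1 : r < 1) (hε : 0 < ε) (hc : 1 < c)
    (F G H : ℤ → ℂ)
    (hF : ∀ k, F k = ErlangA.F r ρ k θ)
    (hG : ∀ k, G k = ErlangA.G ε c ρ k θ)
    (hH : ∀ k, H k = ErlangA.H ε c ρ η m k θ) :
    (∀ n : ℕ, MeasureTheory.IntegrableOn (ErlangA.laplaceIntegrand P N n₀ n θ) (Set.Ioi 0)) ∧
    F m * H (m - 1) - H m * F (m - 1) ≠ 0 ∧
    (∀ n : ℕ, m ≤ n →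
      ErlangA.laplaceProb P N n₀ n θ =
        (Nat.factorial n₀ : ℂ) / (Nat.factorial m : ℂ) * (ρ : ℂ) ^ ((m : ℤ) - (n₀ : ℤ) - 1) *
          (F n₀ * H n / (F m * H (m - 1) - H m * F (m - 1)))) ∧
    (∀ n : ℕ, n₀ ≤ n → n ≤ m →
      ErlangA.laplaceProb P N n₀ n θ =
        (Nat.factorial n₀ : ℂ) * Complex.Gamma θ * Complex.exp (-(ρ : ℂ)) /
            (ρ : ℂ) ^ ((n₀ : ℂ) + θ) * F n₀ *
          (G n + (H m * G (m - 1) - G m * H (m - 1)) /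
            (F m * H (m - 1) - H m * F (m - 1)) * F n)) ∧
    (∀ n : ℕ, n ≤ n₀ →
      ErlangA.laplaceProb P N n₀ n θ =
        (Nat.factorial n₀ : ℂ) * Complex.Gamma θ * Complex.exp (-(ρ : ℂ)) /
            (ρ : ℂ) ^ ((n₀ : ℂ) + θ) * F n *
          (G n₀ + (H m * G (m - 1) - G m * H (m - 1)) /
            (F m * H (m - 1) - H m * F (m - 1)) * F n₀)) := by
  open ErlangA in
  obtain ⟨p, hp, htrans⟩ := hN.exists_transition hinit
  -- From here on the number of servers is `m + 1`.
  obtain ⟨m, rfl⟩ : ∃ l, m = l + 1 := ⟨m - 1, by omega⟩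
  have hm1 : (((m + 1 : ℕ) : ℤ) - 1) = (m : ℤ) := by push_cast; ring
  rw [hm1]
  set d : ℕ → ℝ := deathRate (m + 1) η with hd
  set w : ℕ → ℝ := recipWeight ρ d with hw
  have hd_nonneg : ∀ i, 0 ≤ d i := deathRate_nonneg hη
  have hwpos : ∀ i, 0 < w i := recipWeight_pos hρ (deathRate_succ_pos hη)
  have hw0 : ∀ i, (w i : ℂ) ≠ 0 := fun i => by exact_mod_cast (hwpos i).ne'
  have hρ0 : (ρ : ℂ) ≠ 0 := by exact_mod_cast hρ.ne'
  have hd_le : ∀ i ≤ m + 1, (d i : ℂ) = i := fun i hi => by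
    rw [hd, deathRate_of_le hi]; simp
  have hF_rec : ∀ i : ℕ, ρ * F i - (ρ + θ + (i + 1)) * F (i + 1) + (i + 2) * F (i + 2) = 0 := by
    intro i
    have := F_recursion hr hr1 ρ (i + 1) θ
    simp only [hF]
    rw [add_sub_cancel_right, add_assoc (i : ℤ) 1 1, one_add_one_eq_two] at this
    push_cast at this
    linear_combination this
  have hG_rec : ∀ i : ℕ, ρ * G i - (ρ + θ + (i + 1)) * G (i + 1) + (i + 2) * G (i + 2) = 0 := by
    intro i
    have := G_recursion hε hc hρ hθ (i + 1)
    simp only [hG]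
    push_cast at this
    rw [add_sub_cancel_right, add_assoc (i : ℤ) 1 1, one_add_one_eq_two] at this
    linear_combination this
  -- the regular solution
  set x : ℕ → ℂ := regularSolution ρ d θ with hx
  have hx_eq : ∀ i, BackwardEq ρ d θ x i := backwardEq_regularSolution hρ deathRate_zero θ
  have hx_F : ∀ i ≤ m + 1, x i = F i * w i := by
    refine BackwardEq.eq_of_eq_zero hρ (fun i _ => hx_eq i) (fun i hi => ?_) ?_
    · rcases i with _ | i
      · have h1 := F_recursion hr hr1 ρ 0 θ
        rw [zero_sub, zero_add, F_neg_one hr hr1] at h1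
        have h2 : (w 1 : ℂ) = 1 / ρ := by
          rw [hw, recipWeight_of_le (by omega)]; simp
        have h3 : (w 0 : ℂ) = 1 := by
          rw [hw, recipWeight_of_le (by omega)]; simp
        simp only [BackwardEq, hd_le 0 (by omega), h2, h3, hF, zero_add, zero_mul, Nat.cast_zero,
          Nat.cast_one]
        field_simp
        push_cast at h1
        linear_combination -h1
      · refine backwardEq_of_forward hρ (X := fun i => F i) rfl rfl rfl ?_
        rw [hd_le _ (by omega), hd_le _ (by omega)]
        push_cast
        linear_combination hF_rec i
    · rw [hw, recipWeight_of_le (by omega)]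
      simp [hx, regularSolution, hF, F_zero hr hr1]
  -- the solution that is bounded at infinity
  have hH_eq : ∀ i, m + 1 ≤ i → BackwardEq ρ d θ (fun i => H i * w i) i := by
    intro i hi
    obtain ⟨k, rfl⟩ := exists_add_of_le hi
    rw [show m + 1 + k = m + k + 1 by ring]
    refine backwardEq_of_forward hρ (X := fun i => H i) rfl rfl rfl ?_
    have := H_recursion hε hc hρ hη hθ (m + 1) k
    rw [show m + k + 1 = m + 1 + k by ring, show m + k + 2 = m + 1 + (k + 1) by ring, hd,
      deathRate_add, deathRate_add]
    simp only [hH]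
    push_cast at this ⊢
    rw [show (m : ℤ) + 1 + k - 1 = m + k by ring, add_assoc _ (k : ℤ) 1] at this
    exact this
  have hH_bdd : ∃ B : ℝ, ∀ k : ℕ, ‖H (m + 1 + k : ℕ) * w (m + 1 + k)‖ ≤ B := by
    have hθη : 0 < (θ / η).re := by rw [Complex.div_ofReal_re]; positivity
    have hS : 1 < 1 + ((m + 1 : ℕ) : ℝ) / η := by
      have : 0 < ((m + 1 : ℕ) : ℝ) / η := by positivity
      linarith
    obtain ⟨C, hC⟩ := norm_Gamma_mul_loopKernel_le hε hc hθη hS (div_pos hρ hη)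
    set g := Real.Gamma (1 + ((m + 1 : ℕ) : ℝ) / η) with hg
    have hgpos : 0 < g := Real.Gamma_pos_of_pos (by linarith)
    refine ⟨w (m + 1) / g * C, fun k => ?_⟩
    have hCk := hC k
    rw [Complex.Gamma_ofReal, norm_mul, Complex.norm_real, Real.norm_eq_abs, abs_of_pos
      (Real.Gamma_pos_of_pos (by positivity))] at hCk
    rw [Nat.cast_add, hH, H_eq_loopKernel_add hε hc, hw, recipWeight_add hρ hη, ← hw, norm_mul,
      Complex.norm_real, Real.norm_eq_abs, abs_of_pos (by
        have := hwpos (m + 1)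
        have := Real.Gamma_pos_of_pos (show 0 < 1 + ((m + 1 : ℕ) : ℝ) / η + k by positivity)
        positivity)]
    have hRk : 0 < (ρ / η) ^ k := by positivity
    calc _ = w (m + 1) / g / (ρ / η) ^ k * (Real.Gamma (1 + ((m + 1 : ℕ) : ℝ) / η + k) *
          ‖loopKernel ε c (θ / η) (1 + ((m + 1 : ℕ) : ℝ) / η + k) (ρ / η)‖) := by
          rw [← hg]; field_simp
      _ ≤ w (m + 1) / g / (ρ / η) ^ k * (C * (ρ / η) ^ k) := by
          have := hwpos (m + 1)
          gcongr
      _ = _ := by field_simp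
  have hH_ne : ∃ k : ℕ, H (m + 1 + k : ℕ) * w (m + 1 + k) ≠ 0 := by
    have hθη : 0 < (θ / η).re := by rw [Complex.div_ofReal_re]; positivity
    have hS : 1 < 1 + ((m + 1 : ℕ) : ℝ) / η := by
      have : 0 < ((m + 1 : ℕ) : ℝ) / η := by positivity
      linarith
    obtain ⟨k, hk⟩ := exists_loopKernel_add_nat_ne_zero hε hc hθη hS (div_pos hρ hη)
    refine ⟨k, mul_ne_zero ?_ (hw0 _)⟩
    rwa [Nat.cast_add, hH, H_eq_loopKernel_add hε hc]
  set Δ : ℂ := F (m + 1 : ℕ) * H m - H (m + 1 : ℕ) * F m with hΔ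
  have hΔ0 : Δ ≠ 0 := by
    have := wronskian_ne_zero hρ hd_nonneg hθ (m := m) hx_eq
      (by simp [hx, regularSolution]) hH_eq ?_ ?_
    · rw [hx_F _ le_rfl, hx_F m (by omega)] at this
      intro h0
      refine this ?_
      linear_combination (w (m + 1) : ℂ) * (w m : ℂ) * h0
    · obtain ⟨B, hB⟩ := exists_norm_le_of_exists_norm_le_ge (m := m + 1)
        (v := fun i : ℕ => H i * w i) hH_bdd
      exact ⟨B, fun k => hB _⟩
    · obtain ⟨k, hk⟩ := hH_ne
      exact ⟨1 + k, by rwa [← add_assoc]⟩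
  -- the Wronskian of `F` and `G`
  set g : ℂ := G (-1) with hg
  have hgΓ : Complex.Gamma θ * g = (ρ : ℂ) ^ (θ - 1) * Complex.exp ρ := by
    rw [hg, hG, G_neg_one hε hc hρ hθ]
  -- The weighted Wronskian of `F` and `G` is constant in `n`. Its value is the one at index `-1`,
  -- where `F 0 = 1` and `F (-1) = 0` leave only `G (-1)`.
  have hW : ∀ n : ℕ, n ≤ m → (F (n + 1) * G n - G (n + 1) * F n) * w (n + 1) = g := by
    intro n hn
    induction n with
    | zero =>
      have h1 := F_recursion hr hr1 ρ 0 θ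
      have h2 := G_recursion hε hc hρ hθ 0
      have h3 : (w 1 : ℂ) = 1 / ρ := by
        rw [hw, recipWeight_of_le (by omega)]; simp
      rw [zero_sub, zero_add, F_neg_one hr hr1] at h1
      push_cast at h1 h2
      simp only [← hF, ← hG] at h1 h2
      rw [← hg] at h2
      have h4 : F 0 = 1 := by rw [hF, F_zero hr hr1]
      simp only [Nat.cast_zero, zero_add, h3]
      rw [h4] at h1 ⊢
      field_simp
      linear_combination G 0 * h1 - h2
    | succ n ih =>
      have h1 := hF_rec n
      have h2 := hG_rec n
      rw [← ih (by omega), hw, recipWeight_succ ρ d (n + 1), ← hw]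
      push_cast
      rw [hd_le _ (by omega), add_assoc (n : ℤ) 1 1, one_add_one_eq_two]
      push_cast
      field_simp
      linear_combination (w (n + 1) : ℂ) * (G (n + 1) * h1 - F (n + 1) * h2)
  have hg0 : g ≠ 0 := fun h => by
    rw [h, mul_zero] at hgΓ
    refine mul_ne_zero ?_ (Complex.exp_ne_zero _) hgΓ.symm
    simp [Complex.cpow_eq_zero_iff, hρ0]
  set κ : ℂ := (H (m + 1 : ℕ) * G m - G (m + 1 : ℕ) * H m) / Δ with hκ
  have hκΔ : κ * Δ = H (m + 1 : ℕ) * G m - G (m + 1 : ℕ) * H m := div_mul_cancel₀ _ hΔ0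
  -- the bounded solution to the left of `m + 1`
  set y : ℕ → ℂ := fun i => if i ≤ m then Δ * w (m + 1) / g * (G i + κ * F i) * w i
    else H i * w i with hy
  have hWm : (F (m + 1 : ℕ) * G m - G (m + 1 : ℕ) * F m) * w (m + 1) = g := by
    have := hW m le_rfl
    push_cast
    exact this
  have hmatch : Δ * w (m + 1) / g * (G m + κ * F m) = H m := by
    rw [div_mul_eq_mul_div, div_eq_iff hg0, ← hWm]
    linear_combination (w (m + 1) : ℂ) * (F m * hκΔ + G m * hΔ)
  have hmatch_succ : Δ * w (m + 1) / g * (G (m + 1 : ℕ) + κ * F (m + 1 : ℕ)) = H (m + 1 : ℕ) := by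
    rw [div_mul_eq_mul_div, div_eq_iff hg0, ← hWm]
    linear_combination (w (m + 1) : ℂ) * (F (m + 1 : ℕ) * hκΔ + G (m + 1 : ℕ) * hΔ)
  have hy_left : ∀ i ≤ m + 1, y i = Δ * w (m + 1) / g * (G i + κ * F i) * w i := by
    intro i hi
    rcases Nat.lt_or_ge m i with h | h
    · obtain rfl : i = m + 1 := by omega
      rw [hmatch_succ]
      simp only [hy, if_neg (Nat.not_le.mpr h)]
    · simp only [hy, if_pos h]
  have hy_right : ∀ i, m ≤ i → y i = H i * w i := by
    intro i hi
    rcases hi.eq_or_lt with rfl | h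
    · rw [hy_left _ (by omega), hmatch]
    · simp only [hy, if_neg (Nat.not_le.mpr h)]
  have hy_eq : ∀ i, 1 ≤ i → BackwardEq ρ d θ y i := by
    intro i hi
    rcases Nat.lt_or_ge m i with h | h
    · have := hH_eq i h
      simp only [BackwardEq] at this ⊢
      rw [hy_right i (by omega), hy_right (i + 1) (by omega), hy_right (i - 1) (by omega)]
      exact this
    · obtain ⟨i, rfl⟩ : ∃ l, i = l + 1 := ⟨i - 1, by omega⟩
      refine backwardEq_of_forward hρ (X := fun i => Δ * w (m + 1) / g * (G i + κ * F i))
        (hy_left _ (by omega)) (hy_left _ (by omega)) (hy_left _ (by omega)) ?_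
      rw [hd_le _ (by omega), hd_le _ (by omega)]
      push_cast
      linear_combination Δ * w (m + 1) / g * (hG_rec i + κ * hF_rec i)
  obtain ⟨B, hyB⟩ : ∃ B : ℝ, ∀ i, ‖y i‖ ≤ B := by
    obtain ⟨B, hB⟩ := hH_bdd
    refine exists_norm_le_of_exists_norm_le_ge (m := m + 1) ⟨B, fun k => ?_⟩
    rw [hy_right _ (by omega)]
    exact hB k
  -- The Wronskian is a constant times `w n`; the constant is found at state `m`, where `x` is
  -- weighted `F` and `y` is weighted `H`.
  have hwr : ∀ n, x (n + 1) * y n - x n * y (n + 1) = w (m + 1) * Δ * w n := by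
    have h0 := wronskian_eq hρ hx_eq hy_eq m
    rw [hx_F _ le_rfl, hx_F m (by omega), hy_right m le_rfl, hy_right (m + 1) (by omega),
      ← hw] at h0
    intro n
    rw [wronskian_eq hρ hx_eq hy_eq n, ← hw]
    congr 1
    refine mul_right_cancel₀ (hw0 m) ?_
    rw [← h0, hΔ]
    ring
  have hlap : ∀ n, laplaceProb P N n₀ n θ = IsTransitionFunction.laplace p θ n n₀ := by
    intro n
    simp only [laplaceProb, IsTransitionFunction.laplace, laplaceIntegrand, htrans]
  have hgreen : ∀ n, laplaceProb P N n₀ n θ =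
      x (min n₀ n) * y (max n₀ n) / (ρ * (w (m + 1) * Δ * w n)) := by
    intro n
    rw [hlap, ← hwr n]
    refine green_function hρ hd_nonneg hθ hx_eq hy_eq hyB (hp.norm_laplace_le hθ n) n ?_ ?_ n₀
    · rw [hwr]
      exact mul_ne_zero (mul_ne_zero (hw0 _) hΔ0) (hw0 _)
    · intro i
      have h1 := hp.laplace_backward hθ n i (Finset.range (i + 2)) (by simp) (sum_generator ρ i)
      rw [sum_generator_mul] at h1
      linear_combination h1
  have hw_fact : ∀ i ≤ m + 1, (w i : ℂ) = i.factorial / (ρ : ℂ) ^ i := fun i hi => by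
    rw [hw, recipWeight_of_le hi]; push_cast; rfl
  have hfact : ∀ i : ℕ, (i.factorial : ℂ) ≠ 0 := fun i => by exact_mod_cast i.factorial_ne_zero
  -- The prefactor of the theorem is `w n₀ / (ρ * g)` once `g = G (-1)` is evaluated by the Gamma
  -- formula.
  have hconst : (n₀.factorial : ℂ) * Complex.Gamma θ * Complex.exp (-(ρ : ℂ)) /
      (ρ : ℂ) ^ ((n₀ : ℂ) + θ) = w n₀ / (ρ * g) := by
    have hΓ := Complex.Gamma_ne_zero_of_re_pos hθ
    have hρθ : (ρ : ℂ) ^ θ ≠ 0 := by simp [Complex.cpow_eq_zero_iff, hρ0]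
    have he := Complex.exp_ne_zero (ρ : ℂ)
    rw [hw_fact _ hn₀, Complex.cpow_add _ _ hρ0, Complex.cpow_natCast, Complex.exp_neg]
    rw [Complex.cpow_sub _ _ hρ0, Complex.cpow_one] at hgΓ
    field_simp at hgΓ ⊢
    linear_combination (n₀.factorial : ℂ) * hgΓ
  refine ⟨fun n => ?_, hΔ0, fun n hn => ?_, fun n hn hnm => ?_, fun n hn => ?_⟩
  · have := hp.integrableOn_integrand hθ n₀ n 0
    refine this.congr_fun (fun t _ => ?_) measurableSet_Ioi
    simp only [laplaceIntegrand, htrans]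
  · have hwn := hw0 n
    rw [hgreen, min_eq_left (by omega), max_eq_right (by omega), hx_F _ hn₀,
      hy_right n (by omega), zpow_sub₀ hρ0, zpow_sub₀ hρ0, zpow_natCast, zpow_natCast, zpow_one,
      hw_fact _ hn₀, hw_fact _ le_rfl]
    have := hfact (m + 1)
    field_simp
  · have hwn := hw0 n
    have hwm := hw0 (m + 1)
    rw [hgreen, hconst, min_eq_left hn, max_eq_right hn, hx_F _ hn₀, hy_left n hnm]
    field_simp
  · have hwn := hw0 n
    have hwm := hw0 (m + 1)
    rw [hgreen, hconst, min_eq_right hn, max_eq_left hn, hx_F _ (by omega), hy_left n₀ hn₀]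
    field_simp
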